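/- Let $\mathcal{C}$ be a premodular category over $\mathbb{C}$, i.e. a braided fusion category (a $\mathbb{C}$-linear abelian semisimple rigid monoidal category with bilinear tensor product, finite-dimensional Hom spaces, finitely many isomorphism classes of simple objects, and simple unit object $\mathbb{1}$) with braiding $c$, together with a ribbon structure: a natural automorphism $\theta$ of the identity functor satisfying $\theta_{X\otimes Y}=c_{Y,X}\,c_{X,Y}\,(\theta_X\otimes\theta_Y)$ and $\theta_{X^*}=(\theta_X)^*$. Let $\{X_b\}_b$ be representatives of the isomorphism classes of simple objects. Write $\theta_b\in\mathbb{C}^\times$ for the scalar by which $\theta_{X_b}$ acts, $N_{bc}^a=\dim\operatorname{Hom}(X_b\otimes X_c,X_a)$, $d_b\in\mathbb{C}$ for the quantum dimension of $X_b$, i.e. the scalar $\operatorname{ev}_{X_b}\circ c_{X_b,X_b^*}\circ(\theta_{X_b}\otimes \mathrm{id}_{X_b^*})\circ\operatorname{coev}_{X_b}\in\operatorname{End}(\mathbb{1})=\mathbb{C}$, and $D^2=\sum_b d_b^2$. Then $D^2\neq 0$, and for every simple object $X_a$ the number $$\frac{1}{D^2}\sum_{b,c}N_{bc}^a\,d_b\,d_c\left(\frac{\theta_b}{\theta_c}\right)^2$$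 is real; if moreover $X_a$ is self-dual ($X_a\cong X_a^*$), it is a rational integer. -/

import Mathlib

open CategoryTheory CategoryTheory.Limits MonoidalCategory

universe v u

noncomputable section

namespace Premodular

/-- The set of isomorphism classes of simple objects of `C`. -/
def Irr (C : Type u) [Category.{v} C] [HasZeroMorphisms C] : Type u :=
  Quotient ((isIsomorphicSetoid C).comap (Subtype.val : {X : C // Simple X} → C))

/-- A chosen representative `X_b` of an isomorphism class `b` of simple objects. -/
def Irr.obj {C : Type u} [Category.{v} C] [HasZeroMorphisms C] (b : Irr C) : C :=
  (Quotient.out b).val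

instance {C : Type u} [Category.{v} C] [HasZeroMorphisms C] (b : Irr C) : Simple b.obj :=
  (Quotient.out b).property

attribute [local instance] Abelian.hasFiniteBiproducts

/-- A fusion category over `ℂ`: a `ℂ`-linear abelian rigid monoidal category with bilinear tensor
product and finite-dimensional Hom spaces, in which every object is a finite direct sum of simple
objects, there are finitely many simple objects up to isomorphism, and the unit is simple. -/
class FusionCategory (C : Type u) [Category.{v} C] [Abelian C] [Linear ℂ C] [MonoidalCategory C]
    [MonoidalPreadditive C] [MonoidalLinear ℂ C] [RigidCategory C] : Prop where
  finiteDimensional_hom : ∀ X Y : C, FiniteDimensional ℂ (X ⟶ Y)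
  semisimple : ∀ X : C, ∃ (n : ℕ) (S : Fin n → C),
    (∀ i, Simple (S i)) ∧ Nonempty (X ≅ ⨁ S)
  finite_irr : Finite (Irr C)
  simple_unit : Simple (𝟙_ C)

attribute [instance] FusionCategory.finiteDimensional_hom FusionCategory.finite_irr
  FusionCategory.simple_unit

/-- A ribbon structure on a braided rigid monoidal category: a natural automorphism `θ` of the
identity functor (the balancing, or twist) with `θ_{X ⊗ Y} = c_{Y,X} c_{X,Y} (θ_X ⊗ θ_Y)`
and `θ_{X*} = (θ_X)*`. -/
class RibbonCategory (C : Type u) [Category.{v} C] [MonoidalCategory C] [BraidedCategory C]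
    [RigidCategory C] where
  twist : 𝟭 C ≅ 𝟭 C
  twist_tensor : ∀ X Y : C, twist.hom.app (X ⊗ Y) =
    (twist.hom.app X ⊗ₘ twist.hom.app Y) ≫ (β_ X Y).hom ≫ (β_ Y X).hom
  twist_dual : ∀ X : C, twist.hom.app (Xᘁ) = (twist.hom.app X)ᘁ

/-- The twist `θ_X : X ⟶ X`. -/
def twist {C : Type u} [Category.{v} C] [MonoidalCategory C] [BraidedCategory C]
    [RigidCategory C] [RibbonCategory C] (X : C) : X ⟶ X :=
  (RibbonCategory.twist (C := C)).hom.app X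

/-- The quantum trace `ev_X ∘ c_{X,X*} ∘ ((θ_X ∘ f) ⊗ id_{X*}) ∘ coev_X`, an endomorphism of the
unit object. -/
def traceHom {C : Type u} [Category.{v} C] [MonoidalCategory C] [BraidedCategory C]
    [RigidCategory C] [RibbonCategory C] {X : C} (f : X ⟶ X) : 𝟙_ C ⟶ 𝟙_ C :=
  η_ X Xᘁ ≫ ((f ≫ twist X) ▷ Xᘁ) ≫ (β_ X Xᘁ).hom ≫ ε_ X Xᘁ

section

variable {C : Type u} [Category.{v} C] [Abelian C] [Linear ℂ C] [MonoidalCategory C]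
  [MonoidalPreadditive C] [MonoidalLinear ℂ C] [RigidCategory C] [FusionCategory C]

instance : Fintype (Irr C) := Fintype.ofFinite _

/-- The complex number by which an endomorphism of a simple object acts (Schur's lemma). -/
def scalar {X : C} [Simple X] (f : X ⟶ X) : ℂ :=
  (endomorphism_simple_eq_smul_id ℂ f).choose

theorem scalar_smul_id {X : C} [Simple X] (f : X ⟶ X) : scalar f • 𝟙 X = f :=
  (endomorphism_simple_eq_smul_id ℂ f).choose_spec

/-- The fusion coefficient `N_{YZ}^X = dim Hom(Y ⊗ Z, X)`. -/
def fusionCoeff (Y Z X : C) : ℕ := Module.finrank ℂ (Y ⊗ Z ⟶ X)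

variable [BraidedCategory C] [RibbonCategory C]

/-- The twist `θ_X` of a simple object as a complex number. -/
def twistScalar (X : C) [Simple X] : ℂ := scalar (twist X)

/-- The quantum dimension `d_X`, the trace of the identity of `X`. -/
def dim (X : C) : ℂ := scalar (traceHom (𝟙 X))

variable (C) in
/-- The global dimension `D² = ∑_b d_b²`. -/
def globalDim : ℂ := ∑ b : Irr C, dim b.obj ^ 2

/-- `(1 / D²) ∑_{b,c} N_{bc}^X d_b d_c (θ_b / θ_c)²`. -/
def bantaySum (X : C) : ℂ :=
  (1 / globalDim C) * ∑ b : Irr C, ∑ c : Irr C,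
    (fusionCoeff b.obj c.obj X : ℂ) * dim b.obj * dim c.obj *
      (twistScalar b.obj / twistScalar c.obj) ^ 2

end

end Premodular

end

/-! The normalised sum is a rational integer for every simple `X`; realness and integrality both
follow from this.

By duality, `∑_b N_{bc}^X d_b θ_b²` is the quantum trace of `θ²` on `X ⊗ c*`. The balancing axiom
writes `θ` there as `θ_X θ_c` times the double braiding, so the `θ_c²` in the denominator cancels.
Since the partial trace of the self-braiding of `X` is `θ_X`, one factor `θ_X` turns the trace of
the squared double braiding of `X` with `Y` into the trace of the self-braiding on `X ⊗ X` with a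
loop `Y` around both strands. Splitting `X ⊗ X` into simples `e` gives (`sum_fusionCoeff_eq`) `∑_e
d_e · θ_X tr(c_{X,X} | Hom(e, X ⊗ X)) · ∑_c d_c χ_e(c)`, where `χ_e(c)` is the scalar of a `c`-loop
around `e`.

Each `χ_e` is a character of the fusion ring, and so is `d`. The inner sum therefore vanishes unless
`χ_e = d`, in which case it equals `D²`. In that case `e` is transparent (`doubleBraiding_eq_id`).
If moreover `e` occurs in `X ⊗ X`, then `θ_e = 1`, so `θ_X c_{X,X}` acts as an involution on `Hom(e,
X ⊗ X)` and its trace is an integer.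

It remains that `d_e` is an integer. The antisymmetrizers on tensor powers of `e` have quantum trace
`d_e choose n`, an algebraic integer for every `n`. This forces `d_e` to be an integer, because
norms of such binomials become small.

Finally `D² ≠ 0` because quantum dimensions of simples are nonzero (`dim_ne_zero`) and real
(`conj_dim`). -/

namespace Premodular

/-! ### Graphical calculus: double braiding, partial traces, quantum trace. -/

section Ribbon

variable {C : Type u} [Category.{v} C] [MonoidalCategory C] [BraidedCategory C]

/-- The double braiding `X ⊗ Y ⟶ Y ⊗ X ⟶ X ⊗ Y`. -/
def doubleBraiding (X Y : C) : X ⊗ Y ⟶ X ⊗ Y :=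
  (β_ X Y).hom ≫ (β_ Y X).hom

theorem doubleBraiding_naturality_left {X X' : C} (f : X ⟶ X') (Y : C) :
    f ▷ Y ≫ doubleBraiding X' Y = doubleBraiding X Y ≫ f ▷ Y := by
  simp [doubleBraiding]

theorem doubleBraiding_naturality_right (X : C) {Y Y' : C} (f : Y ⟶ Y') :
    X ◁ f ≫ doubleBraiding X Y' = doubleBraiding X Y ≫ X ◁ f := by
  simp [doubleBraiding]

theorem doubleBraiding_tensor_right (X Y Z : C) :
    doubleBraiding X (Y ⊗ Z) = (α_ X Y Z).inv ≫ (β_ X Y).hom ▷ Z ≫ (α_ Y X Z).hom ≫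
      Y ◁ doubleBraiding X Z ≫ (α_ Y X Z).inv ≫ (β_ Y X).hom ▷ Z ≫ (α_ X Y Z).hom := by
  simp [doubleBraiding, BraidedCategory.braiding_tensor_right_hom,
    BraidedCategory.braiding_tensor_left_hom]

theorem braiding_slide (Z : C) {X Y : C} (u : X ⊗ Y ⟶ 𝟙_ C) :
    (β_ Z X).hom ▷ Y ⊗≫ X ◁ (β_ Z Y).hom ⊗≫ u ▷ Z = 𝟙 _ ⊗≫ Z ◁ u ⊗≫ 𝟙 _ := by
  have h := BraidedCategory.braiding_naturality_right Z u
  rw [BraidedCategory.braiding_tensor_right_hom] at h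
  have h' := (α_ Z X Y).hom ≫= h
  simp only [Category.assoc, Iso.hom_inv_id_assoc, braiding_tensorUnit_right] at h'
  simpa [monoidalComp] using h'.symm

omit [BraidedCategory C] in
/-- A morphism and its mate with respect to two exact pairings. -/
theorem exists_mate {Q R : C} (Q' R' : C) [ExactPairing Q Q'] [ExactPairing R R'] (g : R ⟶ Q) :
    ∃ g' : Q' ⟶ R', η_ R R' ≫ g ▷ R' = η_ Q Q' ≫ Q ◁ g' ∧
      Q' ◁ g ≫ ε_ Q Q' = g' ▷ R ≫ ε_ R R' := by
  let _ : HasRightDual Q := ⟨Q'⟩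
  let _ : HasRightDual R := ⟨R'⟩
  exact ⟨gᘁ, (coevaluation_comp_rightAdjointMate g).symm, (rightAdjointMate_comp_evaluation g).symm⟩

variable [RigidCategory C] [RibbonCategory C]

theorem twist_naturality {X Y : C} (f : X ⟶ Y) : f ≫ twist Y = twist X ≫ f :=
  (RibbonCategory.twist (C := C)).hom.naturality f

theorem twist_tensor (X Y : C) :
    twist (X ⊗ Y) = (twist X ⊗ₘ twist Y) ≫ doubleBraiding X Y :=
  RibbonCategory.twist_tensor X Y

/-- The evaluation `Q ⊗ Q' ⟶ 𝟙` obtained from a pairing of `Q` and `Q'` by the braiding and the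
twist. -/
def twistedEv (Q Q' : C) [ExactPairing Q Q'] : Q ⊗ Q' ⟶ 𝟙_ C :=
  twist Q ▷ Q' ≫ (β_ Q Q').hom ≫ ε_ Q Q'

theorem mate_twistedEv {Q R Q' R' : C} [ExactPairing Q Q'] [ExactPairing R R'] (g : R ⟶ Q)
    (g' : Q' ⟶ R') (h : Q' ◁ g ≫ ε_ Q Q' = g' ▷ R ≫ ε_ R R') :
    g ▷ Q' ≫ twistedEv Q Q' = R ◁ g' ≫ twistedEv R R' := by
  unfold twistedEv
  rw [← comp_whiskerRight_assoc, twist_naturality, comp_whiskerRight_assoc,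
    BraidedCategory.braiding_naturality_left_assoc, h,
    ← BraidedCategory.braiding_naturality_right_assoc, whisker_exchange_assoc]

/-- The partial trace over the right tensor factor. -/
def ptr {A B Q : C} (Q' : C) [ExactPairing Q Q'] (f : A ⊗ Q ⟶ B ⊗ Q) : A ⟶ B :=
  (ρ_ A).inv ≫ A ◁ η_ Q Q' ≫ (α_ A Q Q').inv ≫ f ▷ Q' ≫ (α_ B Q Q').hom ≫
    B ◁ twistedEv Q Q' ≫ (ρ_ B).hom

/-- Slide `g` around the closed strand: its mate passes through the coevaluation, and naturality of
braiding and twist carries it through the twisted evaluation. With `g` the identity this shows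
independence of the chosen dual. -/
theorem ptr_dinatural {A B Q R : C} (Q' R' : C) [ExactPairing Q Q'] [ExactPairing R R']
    (f : A ⊗ Q ⟶ B ⊗ R) (g : R ⟶ Q) :
    ptr Q' (f ≫ B ◁ g) = ptr R' (A ◁ g ≫ f) := by
  obtain ⟨g', h1, h2⟩ := exists_mate Q' R' g
  have h3 := mate_twistedEv g g' h2
  unfold ptr
  have e1 : (B ◁ g) ▷ Q' ≫ (α_ B Q Q').hom ≫ B ◁ twistedEv Q Q' =
      (B ⊗ R) ◁ g' ≫ (α_ B R R').hom ≫ B ◁ twistedEv R R' := by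
    rw [MonoidalCategory.associator_naturality_middle_assoc, ← whiskerLeft_comp, h3]
    simp
  have e2 : A ◁ η_ R R' ≫ (α_ A R R').inv ≫ (A ◁ g) ▷ R' =
      A ◁ η_ Q Q' ≫ (α_ A Q Q').inv ≫ (A ⊗ Q) ◁ g' := by
    rw [← MonoidalCategory.associator_inv_naturality_middle, ← whiskerLeft_comp_assoc, h1]
    simp
  simp only [comp_whiskerRight, Category.assoc]
  rw [reassoc_of% e1, reassoc_of% e2, whisker_exchange_assoc]

theorem ptr_eq_ptr {A B Q : C} (Q' Q'' : C) [ExactPairing Q Q'] [ExactPairing Q Q'']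
    (f : A ⊗ Q ⟶ B ⊗ Q) : ptr Q' f = ptr Q'' f := by
  simpa using ptr_dinatural Q' Q'' f (𝟙 Q)

theorem ptr_comp {A A' B B' Q : C} (Q' : C) [ExactPairing Q Q'] (g : A' ⟶ A)
    (f : A ⊗ Q ⟶ B ⊗ Q) (h : B ⟶ B') :
    ptr Q' (g ▷ Q ≫ f ≫ h ▷ Q) = g ≫ ptr Q' f ≫ h := by
  unfold ptr
  simp only [comp_whiskerRight, Category.assoc]
  have e1 : (ρ_ A').inv ≫ A' ◁ η_ Q Q' ≫ (α_ A' Q Q').inv ≫ g ▷ Q ▷ Q' =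
      g ≫ (ρ_ A).inv ≫ A ◁ η_ Q Q' ≫ (α_ A Q Q').inv := by
    rw [← MonoidalCategory.associator_inv_naturality_left, whisker_exchange_assoc]
    simp
  have e2 : h ▷ Q ▷ Q' ≫ (α_ B' Q Q').hom ≫ B' ◁ twistedEv Q Q' ≫ (ρ_ B').hom =
      (α_ B Q Q').hom ≫ B ◁ twistedEv Q Q' ≫ (ρ_ B).hom ≫ h := by
    rw [MonoidalCategory.associator_naturality_left_assoc, ← whisker_exchange_assoc]
    simp
  rw [reassoc_of% e1, e2]

theorem ptr_whiskerRight_comp {A B B' Q : C} (Q' : C) [ExactPairing Q Q']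
    (f : A ⊗ Q ⟶ B ⊗ Q) (h : B ⟶ B') : ptr Q' (f ≫ h ▷ Q) = ptr Q' f ≫ h := by
  simpa using ptr_comp Q' (𝟙 A) f h

theorem ptr_comp_whiskerRight {A A' B Q : C} (Q' : C) [ExactPairing Q Q'] (g : A' ⟶ A)
    (f : A ⊗ Q ⟶ B ⊗ Q) : ptr Q' (g ▷ Q ≫ f) = g ≫ ptr Q' f := by
  simpa using ptr_comp Q' g f (𝟙 B)

theorem ptr_whiskerLeft (P : C) {A B Q : C} (Q' : C) [ExactPairing Q Q'] (f : A ⊗ Q ⟶ B ⊗ Q) :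
    ptr Q' ((α_ P A Q).hom ≫ P ◁ f ≫ (α_ P B Q).inv) = P ◁ ptr Q' f := by
  unfold ptr
  monoidal

theorem ptr_braiding (Q Q' : C) [ExactPairing Q Q'] : ptr Q' (β_ Q Q).hom = twist Q := by
  have e1 : (β_ Q Q).hom ▷ Q' ≫ (α_ Q Q Q').hom ≫ Q ◁ twist Q ▷ Q' =
      twist Q ▷ Q ▷ Q' ≫ (β_ Q Q).hom ▷ Q' ≫ (α_ Q Q Q').hom := by
    rw [← MonoidalCategory.associator_naturality_middle, ← comp_whiskerRight_assoc,
      ← BraidedCategory.braiding_naturality_left, comp_whiskerRight_assoc]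
  have e2 : (ρ_ Q).inv ≫ Q ◁ η_ Q Q' ≫ (α_ Q Q Q').inv ≫ twist Q ▷ Q ▷ Q' =
      twist Q ≫ (ρ_ Q).inv ≫ Q ◁ η_ Q Q' ≫ (α_ Q Q Q').inv := by
    rw [← MonoidalCategory.associator_inv_naturality_left, whisker_exchange_assoc]
    simp
  have e3 : (α_ Q Q Q').inv ≫ (β_ Q Q).hom ▷ Q' ≫ (α_ Q Q Q').hom ≫ Q ◁ (β_ Q Q').hom =
      (β_ Q (Q ⊗ Q')).hom ≫ (α_ Q Q' Q).hom := by
    rw [BraidedCategory.braiding_tensor_right_hom]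
    simp
  unfold ptr twistedEv
  simp only [whiskerLeft_comp, Category.assoc]
  rw [reassoc_of% e1, reassoc_of% e2, reassoc_of% e3,
    BraidedCategory.braiding_naturality_right_assoc]
  simp

theorem traceHom_eq {Q : C} (Q' : C) [ExactPairing Q Q'] (f : Q ⟶ Q) :
    traceHom f = η_ Q Q' ≫ f ▷ Q' ≫ twistedEv Q Q' := by
  have key : ∀ (Q'' : C) [ExactPairing Q Q''], η_ Q Q'' ≫ f ▷ Q'' ≫ twistedEv Q Q'' =
      ptr Q'' (𝟙_ C ◁ f) := by
    intro Q'' _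
    unfold ptr
    monoidal
  rw [key, ptr_eq_ptr Q' Qᘁ, ← key]
  simp [traceHom, twistedEv]

theorem ptr_whiskerLeft_self (A : C) {Q : C} (Q' : C) [ExactPairing Q Q'] (g : Q ⟶ Q) :
    ptr Q' (A ◁ g) = (ρ_ A).inv ≫ A ◁ traceHom g ≫ (ρ_ A).hom := by
  rw [traceHom_eq Q']
  unfold ptr
  monoidal

theorem traceHom_eq_ptr {Q : C} (Q' : C) [ExactPairing Q Q'] (g : Q ⟶ Q) :
    traceHom g = ptr Q' (𝟙_ C ◁ g) := by
  rw [traceHom_eq Q']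
  unfold ptr
  monoidal

-- The double braiding coming from `θ_{Q ⊗ R}` unlinks two nested loops: naturality moves one of its
-- crossings to the other side, and then `braiding_slide`, used twice, pulls a strand off a cap.
omit [RigidCategory C] [RibbonCategory C] in
theorem twistedEv_tensor_aux (Q R Q' R' : C) [ExactPairing Q Q'] [ExactPairing R R'] :
    doubleBraiding Q R ▷ (R' ⊗ Q') ≫ (β_ (Q ⊗ R) (R' ⊗ Q')).hom ≫ ε_ (Q ⊗ R) (R' ⊗ Q') =
      𝟙 _ ⊗≫ Q ◁ ((β_ R R').hom ≫ ε_ R R') ▷ Q' ⊗≫ (β_ Q Q').hom ≫ ε_ Q Q' := by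
  calc
    _ = (β_ Q R).hom ▷ (R' ⊗ Q') ≫ (β_ (R ⊗ Q) (R' ⊗ Q')).hom ≫
          (R' ⊗ Q') ◁ (β_ R Q).hom ≫ ε_ (Q ⊗ R) (R' ⊗ Q') := by
      rw [doubleBraiding, comp_whiskerRight_assoc,
        BraidedCategory.braiding_naturality_left_assoc]
    _ = 𝟙 _ ⊗≫ (β_ Q R).hom ▷ R' ▷ Q' ⊗≫ R ◁ (β_ Q R').hom ▷ Q' ⊗≫
          ((R ⊗ R') ◁ (β_ Q Q').hom ≫ (β_ R R').hom ▷ (Q' ⊗ Q)) ⊗≫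
          R' ◁ ((β_ R Q').hom ▷ Q ⊗≫ Q' ◁ (β_ R Q).hom ⊗≫ ε_ Q Q' ▷ R) ⊗≫ ε_ R R' := by
      rw [ExactPairing.tensor_evaluation, whisker_exchange]
      simp only [BraidedCategory.braiding_tensor_right_hom,
        BraidedCategory.braiding_tensor_left_hom]
      monoidal
    _ = 𝟙 _ ⊗≫ (β_ Q R).hom ▷ R' ▷ Q' ⊗≫ R ◁ (β_ Q R').hom ▷ Q' ⊗≫ R ◁ R' ◁ (β_ Q Q').hom ⊗≫
          ((β_ R R').hom ▷ (Q' ⊗ Q) ≫ (R' ⊗ R) ◁ ε_ Q Q') ⊗≫ ε_ R R' := by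
      rw [braiding_slide]
      monoidal
    _ = 𝟙 _ ⊗≫ (β_ Q R).hom ▷ R' ▷ Q' ⊗≫ R ◁ (β_ Q R').hom ▷ Q' ⊗≫
          ((R ⊗ R') ◁ ((β_ Q Q').hom ≫ ε_ Q Q') ≫ ((β_ R R').hom ≫ ε_ R R') ▷ 𝟙_ C) ⊗≫ 𝟙 _ := by
      rw [← whisker_exchange]
      monoidal
    _ = 𝟙 _ ⊗≫ ((β_ Q R).hom ▷ R' ⊗≫ R ◁ (β_ Q R').hom ⊗≫
          ((β_ R R').hom ≫ ε_ R R') ▷ Q) ▷ Q' ⊗≫ (β_ Q Q').hom ≫ ε_ Q Q' := by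
      rw [whisker_exchange]
      monoidal
    _ = _ := by
      rw [braiding_slide]
      monoidal

theorem twistedEv_tensor (Q R Q' R' : C) [ExactPairing Q Q'] [ExactPairing R R'] :
    twistedEv (Q ⊗ R) (R' ⊗ Q') = (α_ Q R (R' ⊗ Q')).hom ≫ Q ◁ (α_ R R' Q').inv ≫
      Q ◁ twistedEv R R' ▷ Q' ≫ Q ◁ (λ_ Q').hom ≫ twistedEv Q Q' := by
  rw [twistedEv, twist_tensor, comp_whiskerRight_assoc, twistedEv_tensor_aux]
  unfold twistedEv
  rw [MonoidalCategory.tensorHom_def]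
  calc
    _ = 𝟙 _ ⊗≫ (twist Q ▷ (R ⊗ R') ≫
          Q ◁ (twist R ▷ R' ≫ (β_ R R').hom ≫ ε_ R R')) ▷ Q' ⊗≫ (β_ Q Q').hom ≫ ε_ Q Q' := by
      monoidal
    _ = _ := by
      rw [← whisker_exchange]
      monoidal

theorem ptr_tensor {A B Q R : C} (Q' R' : C) [ExactPairing Q Q'] [ExactPairing R R']
    (f : A ⊗ (Q ⊗ R) ⟶ B ⊗ (Q ⊗ R)) :
    ptr (R' ⊗ Q') f = ptr Q' (ptr R' ((α_ A Q R).hom ≫ f ≫ (α_ B Q R).inv)) := by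
  unfold ptr
  rw [twistedEv_tensor, ExactPairing.tensor_coevaluation]
  monoidal

theorem traceHom_comm {X Y : C} (f : X ⟶ Y) (g : Y ⟶ X) : traceHom (f ≫ g) = traceHom (g ≫ f) := by
  rw [traceHom_eq_ptr Xᘁ, traceHom_eq_ptr Yᘁ, whiskerLeft_comp, whiskerLeft_comp,
    ptr_dinatural Xᘁ Yᘁ]

theorem traceHom_tensor {X Y : C} (Y' : C) [ExactPairing Y Y'] (f : X ⊗ Y ⟶ X ⊗ Y) :
    traceHom f = traceHom (ptr Y' f) := by
  rw [traceHom_eq_ptr (Y' ⊗ Xᘁ), traceHom_eq_ptr Xᘁ, ptr_tensor, ptr_whiskerLeft]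

/-- Pair `Xᘁ` with `X` through the braiding; the twist then moves from `Xᘁ` to `X` by `θ_{X*} =
(θ_X)*`. -/
theorem traceHom_id_rightDual (X : C) : traceHom (𝟙 Xᘁ) = traceHom (𝟙 X) := by
  let _ : ExactPairing Xᘁ X := BraidedCategory.exactPairing_swap X Xᘁ
  have h1 : η_ Xᘁ X = η_ X Xᘁ ≫ (β_ Xᘁ X).inv := rfl
  have h2 : ε_ Xᘁ X = (β_ X Xᘁ).hom ≫ ε_ X Xᘁ := rfl
  have h3 : twist Xᘁ = (twist X)ᘁ := RibbonCategory.twist_dual X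
  rw [traceHom_eq X, traceHom_eq Xᘁ, h1, twistedEv, twistedEv, h2, h3]
  simp only [id_whiskerRight, Category.id_comp, Category.assoc,
    BraidedCategory.braiding_naturality_left_assoc, Iso.inv_hom_id_assoc]
  rw [BraidedCategory.braiding_naturality_right_assoc, rightAdjointMate_comp_evaluation]

theorem exists_eq_comp_twistedEv {Q Q' : C} [ExactPairing Q Q'] (r : Q ⊗ Q' ⟶ 𝟙_ C) :
    ∃ g : Q ⟶ Q, r = g ▷ Q' ≫ twistedEv Q Q' := by
  let _ : ExactPairing Q' Q := BraidedCategory.exactPairing_swap Q Q'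
  have h2 : ε_ Q' Q = (β_ Q Q').hom ≫ ε_ Q Q' := rfl
  refine ⟨tensorRightHomEquiv Q Q' Q (𝟙_ C) r ≫ (λ_ Q).hom ≫
    (RibbonCategory.twist (C := C)).inv.app Q, ?_⟩
  have h : r = (tensorRightHomEquiv Q Q' Q (𝟙_ C) r) ▷ Q' ≫ (α_ _ _ _).hom ≫ _ ◁ ε_ Q' Q ≫
      (ρ_ _).hom := ((tensorRightHomEquiv Q Q' Q (𝟙_ C)).symm_apply_apply r).symm
  have h4 : (RibbonCategory.twist (C := C)).inv.app Q ≫ twist Q = 𝟙 Q :=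
    (RibbonCategory.twist (C := C)).inv_hom_id_app Q
  conv_lhs => rw [h]
  rw [twistedEv, ← comp_whiskerRight_assoc, Category.assoc, Category.assoc, h4, ← h2]
  monoidal

omit [RigidCategory C] [RibbonCategory C] in
theorem doubleBraiding_self_braiding (b a : C) :
    doubleBraiding b (a ⊗ a) ≫ b ◁ (β_ a a).hom = (α_ b a a).inv ≫ doubleBraiding b a ▷ a ≫
      (α_ b a a).hom ≫ b ◁ (β_ a a).hom ≫ (α_ b a a).inv ≫ doubleBraiding b a ▷ a ≫
      (α_ b a a).hom := by
  have y1 := BraidedCategory.yang_baxter a b a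
  have y2 := BraidedCategory.yang_baxter a a b
  rw [doubleBraiding_tensor_right]
  simp only [doubleBraiding, whiskerLeft_comp, comp_whiskerRight, Category.assoc]
  have y3 := y1.symm
  have y4 : (α_ a b a).hom ≫ a ◁ (β_ b a).hom ≫ (α_ a a b).inv ≫ (β_ a a).hom ▷ b ≫
      (α_ a a b).hom ≫ a ◁ (β_ a b).hom ≫ (α_ a b a).inv = (β_ a b).hom ▷ a ≫ (α_ b a a).hom ≫
      b ◁ (β_ a a).hom ≫ (α_ b a a).inv ≫ (β_ b a).hom ▷ a := by
    rw [reassoc_of% y3]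
    simp
  rw [← y2, reassoc_of% y4]

/-- By Yang–Baxter, the double braiding with `a ⊗ a` splits into two copies of the double braiding
with `a`, one on each side of the self-braiding. Closing the last strand then turns the
self-braiding into the twist. -/
theorem traceHom_doubleBraiding_braiding (b a : C) :
    traceHom (doubleBraiding b (a ⊗ a) ≫ b ◁ (β_ a a).hom) =
      traceHom (doubleBraiding b a ≫ b ◁ twist a ≫ doubleBraiding b a) := by
  have h : doubleBraiding b (a ⊗ a) ≫ b ◁ (β_ a a).hom = (α_ b a a).inv ≫
      (doubleBraiding b a ▷ a ≫ ((α_ b a a).hom ≫ b ◁ (β_ a a).hom ≫ (α_ b a a).inv) ≫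
      doubleBraiding b a ▷ a) ≫ (α_ b a a).hom := by
    simpa using doubleBraiding_self_braiding b a
  rw [h, traceHom_comm, Category.assoc, Iso.hom_inv_id, Category.comp_id, traceHom_tensor aᘁ,
    ptr_comp, ptr_whiskerLeft, ptr_braiding]

end Ribbon

/-! ### Numbers with integral binomial coefficients. -/

section Choose

open Filter Topology

/-- The binomial coefficient `z choose n` of a complex number. -/
noncomputable def cchoose (z : ℂ) (n : ℕ) : ℂ := ∏ k ∈ Finset.range n, (z - k) / (k + 1)

theorem cchoose_succ (z : ℂ) (n : ℕ) : cchoose z (n + 1) = cchoose z n * ((z - n) / (n + 1)) :=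
  Finset.prod_range_succ _ _

theorem cchoose_add_one_succ (z : ℂ) (n : ℕ) :
    cchoose (z + 1) (n + 1) = cchoose z n * ((z + 1) / (n + 1)) := by
  induction n with
  | zero => simp [cchoose]
  | succ n ih =>
    rw [cchoose_succ (z + 1), ih, cchoose_succ z]
    push_cast
    ring

theorem cchoose_pascal (z : ℂ) (n : ℕ) :
    cchoose (z + 1) (n + 1) = cchoose z (n + 1) + cchoose z n := by
  rw [cchoose_add_one_succ, cchoose_succ]
  have : (n + 1 : ℂ) ≠ 0 := Nat.cast_add_one_ne_zero n
  field_simp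
  ring

theorem isIntegral_cchoose_add_natCast {z : ℂ} (h : ∀ n, IsIntegral ℤ (cchoose z n)) (j n : ℕ) :
    IsIntegral ℤ (cchoose (z + j) n) := by
  induction j generalizing n with
  | zero => simpa using h n
  | succ j ih =>
    push_cast
    rw [← add_assoc]
    cases n with
    | zero => simpa [cchoose] using ih 0
    | succ n => rw [cchoose_pascal]; exact (ih _).add (ih _)

theorem cchoose_neg (z : ℂ) (n : ℕ) : cchoose (-z) n = (-1) ^ n * cchoose (z + n - 1) n := by
  induction n generalizing z with
  | zero => simp [cchoose]
  | succ n ih =>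
    have h := cchoose_add_one_succ (z + n - 1) n
    rw [cchoose_succ, ih, show z + (n + 1 : ℕ) - 1 = z + n - 1 + 1 by push_cast; ring, h]
    ring

/-- Reflection gives `z + n - 1 choose n` up to sign, and shifts by naturals preserve integrality by
Pascal's rule. -/
theorem isIntegral_cchoose_neg {z : ℂ} (h : ∀ n, IsIntegral ℤ (cchoose z n)) (n : ℕ) :
    IsIntegral ℤ (cchoose (-z) n) := by
  rw [cchoose_neg]
  refine ((isIntegral_one.neg).pow n).mul ?_
  cases n with
  | zero => simpa [cchoose] using isIntegral_one
  | succ n =>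
    have := isIntegral_cchoose_add_natCast h n (n + 1)
    rwa [show z + (n + 1 : ℕ) - 1 = z + n by push_cast; ring]

/-- Each factor is `1 + t ≤ exp t`, with `t` having main term `-(2 Re w + 2) / k`. As the real parts
sum to at least zero, the product loses at least the harmonic term `2 / (k + 1)`; the rest is
summable in `k`. -/
theorem prod_normSq_le {ι : Type*} [Fintype ι] [Nonempty ι] (w : ι → ℂ)
    (hw : 0 ≤ ∑ i, (w i).re) (k : ℕ) :
    ∏ i, Complex.normSq ((w i - k) / (k + 1)) ≤
      Real.exp ((∑ i, Complex.normSq (w i) + 1) * (1 / ((k : ℝ) + 1) ^ 2) - 2 * (1 / (k + 1))) := by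
  have hk : (0 : ℝ) < (k : ℝ) + 1 := by positivity
  have h1 : ∀ i, Complex.normSq ((w i - k) / (k + 1)) ≤
      Real.exp ((Complex.normSq (w i) - 2 * k * (w i).re - (2 * k + 1)) / ((k : ℝ) + 1) ^ 2) := by
    intro i
    refine le_trans (le_of_eq ?_) (Real.add_one_le_exp _)
    rw [Complex.normSq_div]
    have e1 : Complex.normSq ((k : ℂ) + 1) = ((k : ℝ) + 1) ^ 2 := by
      rw [show (k : ℂ) + 1 = (((k : ℝ) + 1 : ℝ) : ℂ) by push_cast; rfl,
        Complex.normSq_ofReal, pow_two]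
    have e2 : Complex.normSq (w i - k) = Complex.normSq (w i) - 2 * k * (w i).re + (k : ℝ) ^ 2 := by
      simp [Complex.normSq_apply]; ring
    rw [e1, e2]
    field_simp
    ring
  refine (Finset.prod_le_prod (fun i _ => Complex.normSq_nonneg _) fun i _ => h1 i).trans ?_
  rw [← Real.exp_sum]
  apply Real.exp_le_exp.2
  have h2 : ∑ i, (Complex.normSq (w i) - 2 * k * (w i).re - (2 * k + 1)) =
      ∑ i, Complex.normSq (w i) - 2 * k * ∑ i, (w i).re - Fintype.card ι * (2 * k + 1) := by
    rw [Finset.sum_sub_distrib, Finset.sum_sub_distrib, Finset.mul_sum]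
    simp only [Finset.sum_const, Finset.card_univ, nsmul_eq_mul]
  rw [← Finset.sum_div, h2]
  have h3 : (1 : ℝ) ≤ Fintype.card ι := by exact_mod_cast Fintype.card_pos
  have h4 : (∑ i, Complex.normSq (w i) + 1) * (1 / ((k : ℝ) + 1) ^ 2) - 2 * (1 / (k + 1)) =
      (∑ i, Complex.normSq (w i) - (2 * k + 1)) / ((k : ℝ) + 1) ^ 2 := by
    field_simp
    ring
  rw [h4]
  apply div_le_div_of_nonneg_right _ (by positivity)
  have h5 : 0 ≤ 2 * (k : ℝ) * ∑ i, (w i).re := by positivity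
  nlinarith

theorem tendsto_prod_normSq_cchoose {ι : Type*} [Fintype ι] [Nonempty ι] (w : ι → ℂ)
    (hw : 0 ≤ ∑ i, (w i).re) :
    Tendsto (fun n => ∏ i, Complex.normSq (cchoose (w i) n)) atTop (𝓝 0) := by
  set S : ℝ := ∑ i, Complex.normSq (w i) + 1
  have hb : ∀ n, ∏ i, Complex.normSq (cchoose (w i) n) ≤ Real.exp
      (S * ∑ k ∈ Finset.range n, (1 / ((k : ℝ) + 1) ^ 2) -
        2 * ∑ k ∈ Finset.range n, (1 / ((k : ℝ) + 1))) := by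
    intro n
    simp only [cchoose, map_prod]
    rw [Finset.prod_comm, Finset.mul_sum, Finset.mul_sum, ← Finset.sum_sub_distrib, Real.exp_sum]
    exact Finset.prod_le_prod (fun k _ => Finset.prod_nonneg fun i _ => Complex.normSq_nonneg _)
      fun k _ => prod_normSq_le w hw k
  have hs : Summable fun k : ℕ => 1 / ((k : ℝ) + 1) ^ 2 := by
    have := (summable_nat_add_iff 1).2 (Real.summable_one_div_nat_pow.2 one_lt_two)
    simpa using this
  refine squeeze_zero (fun n => Finset.prod_nonneg fun i _ => Complex.normSq_nonneg _) hb
    (Real.tendsto_exp_atBot.comp ?_)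
  simp only [sub_eq_add_neg]
  refine (hs.hasSum.tendsto_sum_nat.const_mul S).add_atBot ?_
  exact tendsto_neg_atTop_atBot.comp
    (Real.tendsto_sum_range_one_div_nat_succ_atTop.const_mul_atTop two_pos)

/-- A complex number all of whose binomial coefficients are algebraic integers is an integer. -/
theorem exists_int_of_isIntegral_cchoose {z : ℂ} (h : ∀ n, IsIntegral ℤ (cchoose z n)) :
    ∃ m : ℤ, z = m := by
  have hz : IsIntegral ℤ z := by simpa [cchoose] using h 1
  have hzq : IsIntegral ℚ z := hz.tower_top
  have : FiniteDimensional ℚ (IntermediateField.adjoin ℚ {z}) :=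
    IntermediateField.adjoin.finiteDimensional hzq
  let K := IntermediateField.adjoin ℚ {z}
  -- The norm of `g choose n` is a rational integer and tends to `0`, so it vanishes for some `n`;
  -- hence some factor `g - k` is zero. The sign condition on the trace is met by `z` or by `-z`.
  have key : ∀ g : K, (∀ n, IsIntegral ℤ (cchoose (g : ℂ) n)) →
      0 ≤ ∑ σ : K →ₐ[ℚ] ℂ, (σ g).re → ∃ m : ℕ, (g : ℂ) = m := by
    intro g hg hre
    have : Nonempty (K →ₐ[ℚ] ℂ) := ⟨K.val⟩
    have ht := tendsto_prod_normSq_cchoose (fun σ : K →ₐ[ℚ] ℂ => σ g) hre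
    obtain ⟨n, hn⟩ := (ht.eventually_lt_const zero_lt_one).exists
    let x : K := ∏ k ∈ Finset.range n, (g - k) / (k + 1)
    have hx : ∀ σ : K →ₐ[ℚ] ℂ, σ x = cchoose (σ g) n := by
      intro σ
      simp [x, cchoose]
    have hxi : IsIntegral ℤ x := by
      have h1 : IsIntegral ℤ (K.val x) := (hx K.val).symm ▸ hg n
      exact (isIntegral_algHom_iff (K.val.restrictScalars ℤ) K.val.injective).1 h1
    have hN : IsIntegral ℤ (Algebra.norm ℚ x) := Algebra.isIntegral_norm ℚ hxi
    obtain ⟨m, hm⟩ := IsIntegrallyClosed.isIntegral_iff.1 hN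
    have hprod := Algebra.norm_eq_prod_embeddings ℚ ℂ x
    rw [← hm] at hprod
    have hm2 : ((m ^ 2 : ℤ) : ℝ) < 1 := by
      have h2 := congrArg Complex.normSq hprod
      rw [map_prod] at h2
      simp only [hx] at h2
      rw [← h2] at hn
      simpa [pow_two] using hn
    have hm0 : m = 0 := by
      have h3 : m ^ 2 < 1 := by exact_mod_cast hm2
      nlinarith [sq_nonneg m]
    have hx0 : x = 0 := by
      rw [hm0, map_zero] at hm
      exact Algebra.norm_eq_zero_iff.1 hm.symm
    obtain ⟨k, -, hk⟩ := Finset.prod_eq_zero_iff.1 hx0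
    have hk1 : ((k : K) + 1) ≠ 0 := Nat.cast_add_one_ne_zero k
    rw [div_eq_zero_iff, or_iff_left hk1, sub_eq_zero] at hk
    exact ⟨k, by rw [hk]; simp⟩
  let g : K := IntermediateField.AdjoinSimple.gen ℚ z
  have hgz : (g : ℂ) = z := IntermediateField.AdjoinSimple.coe_gen ℚ z
  rcases le_total 0 (∑ σ : K →ₐ[ℚ] ℂ, (σ g).re) with hpos | hneg
  · obtain ⟨m, hm⟩ := key g (by rwa [hgz]) hpos
    exact ⟨m, by rw [← hgz, hm]; simp⟩
  · obtain ⟨m, hm⟩ := key (-g) (by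
      intro n
      rw [show ((-g : K) : ℂ) = -z by rw [← hgz]; rfl]
      exact isIntegral_cchoose_neg h n) (by simpa using hneg)
    refine ⟨-m, ?_⟩
    have h1 : -z = m := by rw [← hm, ← hgz]; rfl
    rw [← neg_neg z, h1]
    simp

end Choose

noncomputable section

/-! ### Representatives of the simple objects. -/

section Irr

variable {C : Type u} [Category.{v} C] [HasZeroMorphisms C]

theorem Irr.exists_iso (S : C) [hS : Simple S] : ∃ b : Irr C, Nonempty (S ≅ b.obj) := by
  refine ⟨Quotient.mk _ ⟨S, hS⟩, ?_⟩
  have h := Quotient.mk_out (s := (isIsomorphicSetoid C).comap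
    (Subtype.val : {X : C // Simple X} → C)) ⟨S, hS⟩
  exact ⟨(h : IsIsomorphic _ _).some.symm⟩

theorem Irr.eq_of_iso {b c : Irr C} (i : b.obj ≅ c.obj) : b = c := by
  rw [← Quotient.out_eq b, ← Quotient.out_eq c]
  exact Quotient.sound (s := (isIsomorphicSetoid C).comap
    (Subtype.val : {X : C // Simple X} → C)) ⟨i⟩

end Irr

/-! ### Semisimplicity, traces on Hom spaces, quantum dimensions. -/

section Linear

variable {C : Type u} [Category.{v} C] [Abelian C] [Linear ℂ C] [MonoidalCategory C]
  [MonoidalPreadditive C] [MonoidalLinear ℂ C] [RigidCategory C] [FusionCategory C]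

theorem scalar_smul_id_eq {X : C} [Simple X] (z : ℂ) : scalar (z • 𝟙 X) = z := by
  have h := scalar_smul_id (z • 𝟙 X)
  rw [← sub_eq_zero, ← sub_smul, smul_eq_zero, sub_eq_zero] at h
  exact h.resolve_right (id_nonzero X)

theorem scalar_eq_of_eq_smul_id {X : C} [Simple X] {f : X ⟶ X} {z : ℂ} (h : f = z • 𝟙 X) :
    scalar f = z := by
  rw [h, scalar_smul_id_eq]

theorem scalar_add {X : C} [Simple X] (f g : X ⟶ X) : scalar (f + g) = scalar f + scalar g := by
  apply scalar_eq_of_eq_smul_id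
  rw [add_smul, scalar_smul_id, scalar_smul_id]

theorem scalar_smul {X : C} [Simple X] (z : ℂ) (f : X ⟶ X) : scalar (z • f) = z * scalar f := by
  apply scalar_eq_of_eq_smul_id
  rw [mul_smul, scalar_smul_id]

theorem exists_decomposition (X : C) : ∃ (n : ℕ) (S : Fin n → C), (∀ i, Simple (S i)) ∧
    ∃ (p : ∀ i, X ⟶ S i) (j : ∀ i, S i ⟶ X), ∑ i, p i ≫ j i = 𝟙 X := by
  obtain ⟨n, S, hS, ⟨i⟩⟩ := FusionCategory.semisimple X
  have := Abelian.hasFiniteBiproducts (C := C)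
  refine ⟨n, S, hS, fun k => i.hom ≫ biproduct.π S k, fun k => biproduct.ι S k ≫ i.inv, ?_⟩
  have h : ∑ k, biproduct.π S k ≫ biproduct.ι S k = 𝟙 _ := biproduct.total
  calc _ = i.hom ≫ (∑ k, biproduct.π S k ≫ biproduct.ι S k) ≫ i.inv := by
        rw [Preadditive.sum_comp, Preadditive.comp_sum]
        exact Finset.sum_congr rfl fun k _ => by simp
    _ = 𝟙 X := by rw [h]; simp

theorem exists_retraction {S X : C} [Simple S] {f : S ⟶ X} (hf : f ≠ 0) :
    ∃ r : X ⟶ S, f ≫ r = 𝟙 S := by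
  obtain ⟨n, T, hT, p, j, h⟩ := exists_decomposition X
  obtain ⟨i, hi⟩ : ∃ i, f ≫ p i ≠ 0 := by
    by_contra! hc
    apply hf
    rw [← Category.comp_id f, ← h, Preadditive.comp_sum]
    exact Finset.sum_eq_zero fun i _ => by rw [← Category.assoc, hc i, zero_comp]
  have := hT i
  have := isIso_of_hom_simple hi
  exact ⟨p i ≫ inv (f ≫ p i), by rw [← Category.assoc]; simp⟩

/-- Two additive cyclic families of functionals on endomorphisms agree if they agree on
scalar endomorphisms of simple objects. -/
theorem cyclic_ext (T U : ∀ X : C, (X ⟶ X) →ₗ[ℂ] ℂ)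
    (hT : ∀ {X Y : C} (f : X ⟶ Y) (g : Y ⟶ X), T X (f ≫ g) = T Y (g ≫ f))
    (hU : ∀ {X Y : C} (f : X ⟶ Y) (g : Y ⟶ X), U X (f ≫ g) = U Y (g ≫ f))
    (h : ∀ (S : C) [Simple S], T S (𝟙 S) = U S (𝟙 S)) {X : C} (f : X ⟶ X) : T X f = U X f := by
  obtain ⟨n, S, hS, p, j, hpj⟩ := exists_decomposition X
  have e : f = ∑ i, (f ≫ p i) ≫ j i := by
    simp [← Preadditive.comp_sum, hpj]
  rw [e, map_sum, map_sum]
  refine Finset.sum_congr rfl fun i _ => ?_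
  have := hS i
  rw [hT, hU, ← scalar_smul_id (j i ≫ f ≫ p i), map_smul, map_smul, h]

/-- The trace of post-composition with an endomorphism `f` of `X` on `Hom(Y, X)`. -/
def homTrace (Y X : C) : (X ⟶ X) →ₗ[ℂ] ℂ where
  toFun f := LinearMap.trace ℂ (Y ⟶ X) (Linear.rightComp ℂ Y f)
  map_add' f g := by
    rw [← map_add]; congr 1; ext; simp
  map_smul' z f := by
    rw [← map_smul]; congr 1; ext; simp

/-- The trace of pre-composition with an endomorphism `f` of `X` on `Hom(X, Y)`. -/
def homTrace' (Y X : C) : (X ⟶ X) →ₗ[ℂ] ℂ where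
  toFun f := LinearMap.trace ℂ (X ⟶ Y) (Linear.leftComp ℂ Y f)
  map_add' f g := by
    rw [← map_add]; congr 1; ext; simp
  map_smul' z f := by
    rw [← map_smul]; congr 1; ext; simp

omit [MonoidalCategory C] [MonoidalPreadditive C] [MonoidalLinear ℂ C] [RigidCategory C]
  [FusionCategory C] in
theorem homTrace_apply {Y X : C} (f : X ⟶ X) :
    homTrace Y X f = LinearMap.trace ℂ (Y ⟶ X) (Linear.rightComp ℂ Y f) := rfl

omit [MonoidalCategory C] [MonoidalPreadditive C] [MonoidalLinear ℂ C] [RigidCategory C]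
  [FusionCategory C] in
theorem homTrace'_apply {Y X : C} (f : X ⟶ X) :
    homTrace' Y X f = LinearMap.trace ℂ (X ⟶ Y) (Linear.leftComp ℂ Y f) := rfl

theorem homTrace_comm (Y : C) {X X' : C} (f : X ⟶ X') (g : X' ⟶ X) :
    homTrace Y X (f ≫ g) = homTrace Y X' (g ≫ f) := by
  have h := LinearMap.trace_comp_comm' (R := ℂ) (Linear.rightComp ℂ Y f) (Linear.rightComp ℂ Y g)
  rw [homTrace_apply, homTrace_apply]
  convert h using 2 <;> (ext; simp)

theorem homTrace'_comm (Y : C) {X X' : C} (f : X ⟶ X') (g : X' ⟶ X) :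
    homTrace' Y X (f ≫ g) = homTrace' Y X' (g ≫ f) := by
  have h := LinearMap.trace_comp_comm' (R := ℂ) (Linear.leftComp ℂ Y g) (Linear.leftComp ℂ Y f)
  rw [homTrace'_apply, homTrace'_apply]
  convert h using 2 <;> (ext; simp)

theorem homTrace_id (Y X : C) : homTrace Y X (𝟙 X) = Module.finrank ℂ (Y ⟶ X) := by
  rw [homTrace_apply, ← LinearMap.trace_one ℂ (Y ⟶ X)]
  congr 1; ext; simp

theorem homTrace'_id (Y X : C) : homTrace' Y X (𝟙 X) = Module.finrank ℂ (X ⟶ Y) := by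
  rw [homTrace'_apply, ← LinearMap.trace_one ℂ (X ⟶ Y)]
  congr 1; ext; simp

theorem finrank_hom_comm_of_simple (S T : C) [Simple S] [Simple T] :
    Module.finrank ℂ (S ⟶ T) = Module.finrank ℂ (T ⟶ S) := by
  classical
  rw [finrank_hom_simple_simple, finrank_hom_simple_simple]
  exact if_congr ⟨fun ⟨i⟩ => ⟨i.symm⟩, fun ⟨i⟩ => ⟨i.symm⟩⟩ rfl rfl

theorem homTrace_eq_homTrace' (Y : C) [Simple Y] {X : C} (f : X ⟶ X) :
    homTrace Y X f = homTrace' Y X f :=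
  cyclic_ext (fun X => homTrace Y X) (fun X => homTrace' Y X) (homTrace_comm Y) (homTrace'_comm Y)
    (fun S _ => by simp only [homTrace_id, homTrace'_id, finrank_hom_comm_of_simple Y S]) f

theorem finrank_hom_comm (Y : C) [Simple Y] (X : C) :
    Module.finrank ℂ (Y ⟶ X) = Module.finrank ℂ (X ⟶ Y) := by
  have h := homTrace_eq_homTrace' Y (𝟙 X)
  rw [homTrace_id, homTrace'_id] at h
  exact_mod_cast h

/-- An additive cyclic family of functionals on endomorphisms is determined by its values on the
identities of the simple objects. -/
theorem cyclic_eq_sum_homTrace (T : ∀ X : C, (X ⟶ X) →ₗ[ℂ] ℂ)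
    (hT : ∀ {X Y : C} (f : X ⟶ Y) (g : Y ⟶ X), T X (f ≫ g) = T Y (g ≫ f)) {X : C} (f : X ⟶ X) :
    T X f = ∑ e : Irr C, T e.obj (𝟙 e.obj) * homTrace e.obj X f := by
  have h := cyclic_ext T (fun X => ∑ e : Irr C, T e.obj (𝟙 e.obj) • homTrace e.obj X)
    hT (fun f g => by simp [homTrace_comm _ f g]) (fun S hS => by
      obtain ⟨b, ⟨i⟩⟩ := Irr.exists_iso S
      simp only [LinearMap.sum_apply, LinearMap.smul_apply, homTrace_id, smul_eq_mul]
      rw [Finset.sum_eq_single b]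
      · rw [(finrank_hom_simple_simple_eq_one_iff ℂ b.obj S).2 ⟨i.symm⟩, ← i.hom_inv_id, hT,
          i.inv_hom_id]
        simp
      · intro c _ hc
        rw [(finrank_hom_simple_simple_eq_zero_iff ℂ c.obj S).2
          ⟨fun k => hc (Irr.eq_of_iso (k ≪≫ i))⟩]
        simp
      · simp) f
  simpa using h

/-- The bijection `Hom(X ⊗ Y, Z) ≃ Hom(X, Z ⊗ Y')` for an exact pairing of `Y` and `Y'`. -/
def tensorRightHomLinearEquiv (X Y Y' Z : C) [ExactPairing Y Y'] :
    (X ⊗ Y ⟶ Z) ≃ₗ[ℂ] (X ⟶ Z ⊗ Y') where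
  __ := tensorRightHomEquiv X Y Y' Z
  map_add' f g := by simp [tensorRightHomEquiv]
  map_smul' z f := by simp [tensorRightHomEquiv]

/-- The bijection `Hom(Y' ⊗ X, Z) ≃ Hom(X, Y ⊗ Z)` for an exact pairing of `Y` and `Y'`. -/
def tensorLeftHomLinearEquiv (X Y Y' Z : C) [ExactPairing Y Y'] :
    (Y' ⊗ X ⟶ Z) ≃ₗ[ℂ] (X ⟶ Y ⊗ Z) where
  __ := tensorLeftHomEquiv X Y Y' Z
  map_add' f g := by simp [tensorLeftHomEquiv]
  map_smul' z f := by simp [tensorLeftHomEquiv]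

variable [BraidedCategory C] [RibbonCategory C]

/-- The quantum trace as a complex number. -/
def qtr (X : C) : (X ⟶ X) →ₗ[ℂ] ℂ where
  toFun f := scalar (traceHom f)
  map_add' f g := by
    rw [← scalar_add]; congr 1; simp [traceHom]
  map_smul' z f := by
    rw [RingHom.id_apply, smul_eq_mul, ← scalar_smul]; congr 1; simp [traceHom]

theorem qtr_apply {X : C} (f : X ⟶ X) : qtr X f = scalar (traceHom f) := rfl

theorem traceHom_eq_smul {X : C} (f : X ⟶ X) : traceHom f = qtr X f • 𝟙 (𝟙_ C) :=
  (scalar_smul_id _).symm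

theorem dim_eq (X : C) : dim X = qtr X (𝟙 X) := rfl

theorem qtr_comm {X Y : C} (f : X ⟶ Y) (g : Y ⟶ X) : qtr X (f ≫ g) = qtr Y (g ≫ f) := by
  rw [qtr_apply, qtr_apply, traceHom_comm]

theorem dim_eq_of_iso {X Y : C} (i : X ≅ Y) : dim X = dim Y := by
  rw [dim_eq, dim_eq, ← i.hom_inv_id, qtr_comm, i.inv_hom_id]

theorem qtr_of_simple {X : C} [Simple X] (f : X ⟶ X) : qtr X f = scalar f * dim X := by
  conv_lhs => rw [← scalar_smul_id f]
  rw [map_smul, smul_eq_mul, dim_eq]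

theorem qtr_eq_sum_homTrace {X : C} (f : X ⟶ X) :
    qtr X f = ∑ e : Irr C, dim e.obj * homTrace e.obj X f :=
  cyclic_eq_sum_homTrace (fun X => qtr X) qtr_comm f

theorem dim_eq_sum (X : C) :
    dim X = ∑ e : Irr C, dim e.obj * Module.finrank ℂ (e.obj ⟶ X) := by
  simp only [dim_eq X, qtr_eq_sum_homTrace, homTrace_id]

/-- The coevaluation is a nonzero map out of a simple object, hence split. Its retraction is the
twisted evaluation precomposed with some `g : X ⟶ X`, so `g` has trace `1`, while `g` is a scalar
and its trace a multiple of `dim X`. -/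
theorem dim_ne_zero (X : C) [Simple X] : dim X ≠ 0 := by
  have hη : η_ X Xᘁ ≠ 0 := by
    intro h
    have h1 := ExactPairing.evaluation_coevaluation X Xᘁ
    rw [h, MonoidalPreadditive.zero_whiskerRight, zero_comp] at h1
    apply id_nonzero X
    calc 𝟙 X = (λ_ X).inv ≫ ((λ_ X).hom ≫ (ρ_ X).inv) ≫ (ρ_ X).hom := by simp
      _ = 0 := by rw [← h1, zero_comp, comp_zero]
  obtain ⟨r, hr⟩ := exists_retraction hη
  obtain ⟨g, hg⟩ := exists_eq_comp_twistedEv r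
  intro h0
  have h1 : traceHom g = 𝟙 (𝟙_ C) := by rw [traceHom_eq Xᘁ, ← hg, hr]
  have h2 : qtr X g = 1 := by
    rw [qtr_apply, h1]; exact scalar_eq_of_eq_smul_id (one_smul _ _).symm
  rw [qtr_of_simple, h0, mul_zero] at h2
  exact zero_ne_one h2

/-- Nondegeneracy of the trace pairing: a nonzero `g` is split on some simple summand, where a
suitable `f` gives a nonzero dimension as trace. -/
theorem eq_zero_of_qtr_eq_zero {X Y : C} (g : X ⟶ Y) (h : ∀ f : Y ⟶ X, qtr Y (f ≫ g) = 0) :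
    g = 0 := by
  by_contra hg
  obtain ⟨n, S, hS, p, j, hpj⟩ := exists_decomposition X
  obtain ⟨i, hi⟩ : ∃ i, j i ≫ g ≠ 0 := by
    by_contra! hc
    apply hg
    rw [← Category.id_comp g, ← hpj, Preadditive.sum_comp]
    exact Finset.sum_eq_zero fun i _ => by rw [Category.assoc, hc i, comp_zero]
  have := hS i
  obtain ⟨r, hr⟩ := exists_retraction hi
  have h1 := h (r ≫ j i)
  rw [Category.assoc, qtr_comm, hr, ← dim_eq] at h1
  exact dim_ne_zero _ h1

omit [Linear ℂ C] [MonoidalLinear ℂ C] [FusionCategory C] in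
theorem ptr_add {A B Q : C} (Q' : C) [ExactPairing Q Q'] (f g : A ⊗ Q ⟶ B ⊗ Q) :
    ptr Q' (f + g) = ptr Q' f + ptr Q' g := by
  simp [ptr]

omit [FusionCategory C] in
theorem ptr_smul {A B Q : C} (Q' : C) [ExactPairing Q Q'] (z : ℂ) (f : A ⊗ Q ⟶ B ⊗ Q) :
    ptr Q' (z • f) = z • ptr Q' f := by
  simp [ptr]

theorem ptr_whiskerLeft_eq_smul (A : C) {Q : C} (Q' : C) [ExactPairing Q Q'] (g : Q ⟶ Q) :
    ptr Q' (A ◁ g) = qtr Q g • 𝟙 A := by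
  rw [ptr_whiskerLeft_self, traceHom_eq_smul]
  simp

theorem ptr_id (A : C) {Q : C} (Q' : C) [ExactPairing Q Q'] :
    ptr Q' (𝟙 (A ⊗ Q)) = dim Q • 𝟙 A := by
  rw [← whiskerLeft_id, ptr_whiskerLeft_eq_smul, dim_eq]

theorem qtr_tensor {X Y : C} (Y' : C) [ExactPairing Y Y'] (f : X ⊗ Y ⟶ X ⊗ Y) :
    qtr (X ⊗ Y) f = qtr X (ptr Y' f) := by
  rw [qtr_apply, qtr_apply, traceHom_tensor Y']

theorem dim_tensor (X Y : C) : dim (X ⊗ Y) = dim X * dim Y := by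
  rw [dim_eq, qtr_tensor Yᘁ, ptr_id, map_smul, smul_eq_mul, dim_eq X, mul_comm]

theorem dim_rightDual (X : C) : dim Xᘁ = dim X := by
  rw [dim_eq, dim_eq, qtr_apply, qtr_apply, traceHom_id_rightDual]

theorem sum_dim_mul_fusionCoeff_left (c X : C) :
    ∑ b : Irr C, dim b.obj * (fusionCoeff b.obj c X : ℂ) = dim X * dim c := by
  rw [← dim_rightDual c, ← dim_tensor, dim_eq_sum]
  refine Finset.sum_congr rfl fun b _ => ?_
  rw [fusionCoeff, (tensorRightHomLinearEquiv b.obj c cᘁ X).finrank_eq]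

theorem sum_dim_mul_fusionCoeff (b c : C) :
    ∑ e : Irr C, dim e.obj * (fusionCoeff b c e.obj : ℂ) = dim b * dim c := by
  rw [← dim_tensor, dim_eq_sum]
  simp only [fusionCoeff, finrank_hom_comm]

theorem sum_dim_mul_conj_ne_zero :
    ∑ b : Irr C, dim b.obj * (starRingEnd ℂ) (dim b.obj) ≠ 0 := by
  obtain ⟨e, -⟩ := Irr.exists_iso (𝟙_ C)
  simp only [Complex.mul_conj]
  rw [← Complex.ofReal_sum, Complex.ofReal_ne_zero]
  refine (Finset.sum_pos (fun b _ => ?_) ⟨e, Finset.mem_univ e⟩).ne'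
  exact Complex.normSq_pos.2 (dim_ne_zero _)

/-- The vector `d` is an eigenvector, with eigenvalue `dim X`, of both the matrix of fusion with `X`
and its transpose. Evaluating `∑ conj(d_b) N_{bX}^e d_e` in both ways gives `dim X` and its
conjugate times the same nonzero sum. -/
theorem conj_dim (X : C) [Simple X] : (starRingEnd ℂ) (dim X) = dim X := by
  have h1 : ∑ b : Irr C, ∑ e : Irr C,
      (starRingEnd ℂ) (dim b.obj) * (dim e.obj * (fusionCoeff b.obj X e.obj : ℂ)) =
      dim X * ∑ b : Irr C, dim b.obj * (starRingEnd ℂ) (dim b.obj) := by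
    simp only [← Finset.mul_sum, sum_dim_mul_fusionCoeff]
    rw [Finset.mul_sum]
    exact Finset.sum_congr rfl fun _ _ => by ring
  have h2 : ∑ b : Irr C, ∑ e : Irr C,
      (starRingEnd ℂ) (dim b.obj) * (dim e.obj * (fusionCoeff b.obj X e.obj : ℂ)) =
      (starRingEnd ℂ) (dim X) * ∑ b : Irr C, dim b.obj * (starRingEnd ℂ) (dim b.obj) := by
    rw [Finset.sum_comm, Finset.mul_sum]
    refine Finset.sum_congr rfl fun e _ => ?_
    have h3 := congrArg (starRingEnd ℂ) (sum_dim_mul_fusionCoeff_left X e.obj)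
    simp only [map_sum, map_mul, Complex.conj_natCast] at h3
    calc _ = dim e.obj * ∑ b : Irr C, (starRingEnd ℂ) (dim b.obj) *
          (fusionCoeff b.obj X e.obj : ℂ) := by
          rw [Finset.mul_sum]
          exact Finset.sum_congr rfl fun _ _ => by ring
      _ = _ := by rw [h3]; ring
  exact (mul_right_cancel₀ sum_dim_mul_conj_ne_zero (h1.symm.trans h2)).symm

theorem globalDim_ne_zero : globalDim C ≠ 0 := by
  have h := sum_dim_mul_conj_ne_zero (C := C)
  simp only [conj_dim, ← pow_two] at h
  exact h

/-- The ℤ-span of the dimensions of simples is finitely generated, nonzero and stable under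
multiplication by each of them. -/
theorem isIntegral_dim (X : C) : IsIntegral ℤ (dim X) := by
  have key : ∀ e : Irr C, IsIntegral ℤ (dim e.obj) := by
    intro e
    let M : Submodule ℤ ℂ := Submodule.span ℤ (Set.range fun b : Irr C => dim b.obj)
    have hM : ∀ X : C, dim X ∈ M := by
      intro X
      rw [dim_eq_sum]
      refine Submodule.sum_mem _ fun b _ => ?_
      rw [mul_comm, ← nsmul_eq_mul]
      exact Submodule.smul_of_tower_mem M _ (Submodule.subset_span ⟨b, rfl⟩)
    refine isIntegral_of_smul_mem_submodule (M := ℂ) M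
      (fun h => dim_ne_zero e.obj ((Submodule.eq_bot_iff M).1 h _ (hM _)))
      (Submodule.fg_span (Set.finite_range _)) _ fun x hx => ?_
    induction hx using Submodule.span_induction with
    | mem x hx =>
      obtain ⟨b, rfl⟩ := hx
      rw [smul_eq_mul, ← dim_tensor]
      exact hM _
    | zero => simp
    | add x y _ _ hx hy => rw [smul_add]; exact M.add_mem hx hy
    | smul n x _ hx => rw [smul_comm]; exact M.smul_mem n hx
  rw [dim_eq_sum]
  exact IsIntegral.sum _ fun e _ => (key e).mul (isIntegral_algebraMap (x := (_ : ℤ)))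

end Linear

/-! ### Encircling characters and transparent objects. -/

section Transparent

variable {C : Type u} [Category.{v} C] [Abelian C] [Linear ℂ C] [MonoidalCategory C]
  [MonoidalPreadditive C] [MonoidalLinear ℂ C] [RigidCategory C] [FusionCategory C]
  [BraidedCategory C] [RibbonCategory C]

/-- The endomorphism of `X` obtained by encircling `X` by a closed strand labelled by `V`. -/
def encircle (V X : C) : X ⟶ X := ptr Vᘁ (doubleBraiding X V)

omit [Abelian C] [Linear ℂ C] [MonoidalPreadditive C] [MonoidalLinear ℂ C] [FusionCategory C] in
theorem encircle_naturality (V : C) {X Y : C} (f : X ⟶ Y) :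
    f ≫ encircle V Y = encircle V X ≫ f := by
  rw [encircle, encircle, ← ptr_comp_whiskerRight, doubleBraiding_naturality_left,
    ptr_whiskerRight_comp]

omit [Abelian C] [Linear ℂ C] [MonoidalPreadditive C] [MonoidalLinear ℂ C] [FusionCategory C] in
theorem ptr_doubleBraiding_tensor (X Y Z : C) :
    ptr Zᘁ ((α_ X Y Z).hom ≫ doubleBraiding X (Y ⊗ Z) ≫ (α_ X Y Z).inv) =
      (β_ X Y).hom ≫ Y ◁ encircle Z X ≫ (β_ Y X).hom := by
  rw [encircle, ← ptr_whiskerLeft, ← ptr_comp, doubleBraiding_tensor_right]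
  simp

/-- The scalar by which encircling by `V` acts on the simple object `X`. -/
def chi (X : C) [Simple X] (V : C) : ℂ := scalar (encircle V X)

theorem encircle_eq_smul (X : C) [Simple X] (V : C) : encircle V X = chi X V • 𝟙 X :=
  (scalar_smul_id _).symm

/-- A loop `Y ⊗ Z` is two nested loops; the inner one is a scalar on `X` and comes out. -/
theorem encircle_tensor (X : C) [Simple X] (Y Z : C) :
    encircle (Y ⊗ Z) X = (chi X Y * chi X Z) • 𝟙 X := by
  rw [encircle, ptr_eq_ptr _ (Zᘁ ⊗ Yᘁ), ptr_tensor, ptr_doubleBraiding_tensor, encircle_eq_smul]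
  have h : (β_ X Y).hom ≫ Y ◁ (chi X Z • 𝟙 X) ≫ (β_ Y X).hom = chi X Z • doubleBraiding X Y := by
    simp [doubleBraiding]
  rw [h, ptr_smul, ← encircle, encircle_eq_smul, smul_smul, mul_comm]

theorem chi_tensor (X : C) [Simple X] (Y Z : C) : chi X (Y ⊗ Z) = chi X Y * chi X Z :=
  scalar_eq_of_eq_smul_id (encircle_tensor X Y Z)

theorem chi_eq_sum (X : C) [Simple X] (V : C) :
    chi X V = ∑ e : Irr C, chi X e.obj * Module.finrank ℂ (e.obj ⟶ V) := by
  let T : ∀ V : C, (V ⟶ V) →ₗ[ℂ] ℂ := fun V =>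
    { toFun f := scalar (ptr Vᘁ (doubleBraiding X V ≫ X ◁ f))
      map_add' f g := by
        rw [MonoidalPreadditive.whiskerLeft_add, Preadditive.comp_add, ptr_add, scalar_add]
      map_smul' z f := by
        rw [MonoidalLinear.whiskerLeft_smul, Linear.comp_smul, ptr_smul, scalar_smul,
          RingHom.id_apply, smul_eq_mul] }
  have hT : ∀ V, T V (𝟙 V) = chi X V := fun V => by
    change scalar (ptr Vᘁ (doubleBraiding X V ≫ X ◁ 𝟙 V)) = _
    rw [whiskerLeft_id, Category.comp_id, chi, encircle]
  have h := cyclic_eq_sum_homTrace T (fun {V W} f g => by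
    change scalar (ptr Vᘁ (doubleBraiding X V ≫ X ◁ (f ≫ g))) =
      scalar (ptr Wᘁ (doubleBraiding X W ≫ X ◁ (g ≫ f)))
    rw [whiskerLeft_comp, ← Category.assoc, ptr_dinatural Vᘁ Wᘁ, ← Category.assoc,
      doubleBraiding_naturality_right, whiskerLeft_comp, Category.assoc]) (𝟙 V)
  simpa only [hT, homTrace_id] using h

theorem chi_congr (X : C) [Simple X] {V W : C} (i : V ≅ W) : chi X V = chi X W := by
  rw [chi_eq_sum X V, chi_eq_sum X W]
  refine Finset.sum_congr rfl fun e _ => ?_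
  rw [LinearEquiv.finrank_eq (Linear.homCongr ℂ (Iso.refl e.obj) i)]

/-- Orthogonality of characters: multiplying the sum by `chi X b` or by `dim b` gives the same
result. -/
theorem sum_dim_mul_chi_eq_zero (X : C) [Simple X] {b : Irr C} (hb : chi X b.obj ≠ dim b.obj) :
    ∑ e : Irr C, dim e.obj * chi X e.obj = 0 := by
  have h : chi X b.obj * ∑ e : Irr C, dim e.obj * chi X e.obj =
      dim b.obj * ∑ e : Irr C, dim e.obj * chi X e.obj := by
    calc _ = ∑ c : Irr C, dim c.obj * chi X (c.obj ⊗ b.obj) := by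
          rw [Finset.mul_sum]
          exact Finset.sum_congr rfl fun c _ => by rw [chi_tensor]; ring
      _ = ∑ c : Irr C, ∑ e : Irr C, dim c.obj * (chi X e.obj *
          fusionCoeff c.obj b.obj e.obj) := by
          refine Finset.sum_congr rfl fun c _ => ?_
          simp only [chi_eq_sum X (c.obj ⊗ b.obj), Finset.mul_sum, finrank_hom_comm, fusionCoeff]
      _ = ∑ e : Irr C, chi X e.obj * ∑ c : Irr C, dim c.obj * fusionCoeff c.obj b.obj e.obj := by
          rw [Finset.sum_comm]
          simp only [Finset.mul_sum]
          exact Finset.sum_congr rfl fun e _ => Finset.sum_congr rfl fun c _ => by ring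
      _ = _ := by
          simp only [sum_dim_mul_fusionCoeff_left]
          rw [Finset.mul_sum]
          exact Finset.sum_congr rfl fun c _ => by ring
  by_contra h0
  exact hb (mul_right_cancel₀ h0 h)

omit [BraidedCategory C] [RibbonCategory C] in
theorem simple_rightDual (X : C) [Simple X] : Simple Xᘁ := by
  have h1 : Module.finrank ℂ (Xᘁ ⟶ Xᘁ) = 1 := by
    rw [← finrank_endomorphism_simple_eq_one ℂ X,
      (Linear.homCongr ℂ (ρ_ Xᘁ).symm (Iso.refl Xᘁ)).finrank_eq,
      (Linear.homCongr ℂ (λ_ X).symm (Iso.refl X)).finrank_eq,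
      (tensorLeftHomLinearEquiv (𝟙_ C) X Xᘁ Xᘁ).finrank_eq,
      (tensorRightHomLinearEquiv (𝟙_ C) X Xᘁ X).finrank_eq]
  have h0 : 𝟙 Xᘁ ≠ 0 := by
    intro h
    have : Subsingleton (Xᘁ ⟶ Xᘁ) :=
      subsingleton_of_forall_eq 0 fun f => by rw [← Category.comp_id f, h, comp_zero]
    rw [Module.finrank_zero_of_subsingleton] at h1
    exact zero_ne_one h1
  obtain ⟨n, S, hS, p, j, hpj⟩ := exists_decomposition Xᘁ
  obtain ⟨i, hi⟩ : ∃ i, j i ≠ 0 := by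
    by_contra! hc
    apply h0
    rw [← hpj]
    exact Finset.sum_eq_zero fun i _ => by rw [hc i, comp_zero]
  have := hS i
  obtain ⟨r, hr⟩ := exists_retraction hi
  obtain ⟨z, hz⟩ := (finrank_eq_one_iff_of_nonzero' _ h0).1 h1 (r ≫ j i)
  have h2 : j i ≫ r ≫ j i = z • j i := by rw [← hz]; simp
  rw [reassoc_of% hr] at h2
  have hz1 : z = 1 := by
    have h3 : (z - 1) • j i = 0 := by rw [sub_smul, ← h2, one_smul, sub_self]
    rw [smul_eq_zero, sub_eq_zero] at h3
    exact h3.resolve_right hi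
  exact Simple.of_iso (Y := S i) ⟨r, j i, by rw [← hz, hz1, one_smul], hr⟩

omit [BraidedCategory C] [RibbonCategory C] in
theorem sum_rightDual (F : C → ℂ) (hF : ∀ {X Y : C}, (X ≅ Y) → F X = F Y) :
    ∑ b : Irr C, F b.objᘁ = ∑ b : Irr C, F b.obj := by
  have h : ∀ b : Irr C, ∃ c : Irr C, Nonempty (b.objᘁ ≅ c.obj) := fun b =>
    have := simple_rightDual b.obj
    Irr.exists_iso _
  choose σ i using h
  have hσ : Function.Injective σ := fun b c hbc => by
    obtain ⟨j⟩ := i b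
    obtain ⟨k⟩ := i c
    rw [← hbc] at k
    -- Now `b` and `c` are both left duals of `b*`, hence isomorphic.
    let _ : ExactPairing c.obj (b.objᘁ) := exactPairingCongrRight (j ≪≫ k.symm)
    exact Irr.eq_of_iso (leftDualIso (Y := b.objᘁ) inferInstance inferInstance)
  have hb : Function.Bijective σ := Finite.injective_iff_bijective.1 hσ
  rw [← Equiv.sum_comp (Equiv.ofBijective σ hb) fun b => F b.obj]
  exact Finset.sum_congr rfl fun b _ => hF (Y := (σ b).obj) (i b).some

-- Rotating `b` to the other side identifies `Hom(b ⊗ e, e')` with `Hom(e, b' ⊗ e')`, and conjugates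
-- the two operators into each other; `s` below is the mate of `h`.
omit [RigidCategory C] [FusionCategory C] [BraidedCategory C] [RibbonCategory C] in
theorem homTrace'_tensor_eq {A b b' e e' : C} [ExactPairing b' b] (ψ : ∀ V : C, A ⊗ V ⟶ V)
    (hψ : ∀ {V W : C} (f : V ⟶ W), A ◁ f ≫ ψ W = ψ V ≫ f) (h : b ⟶ A ⊗ b) :
    homTrace' e' (b ⊗ e) (h ▷ e ≫ (α_ A b e).hom ≫ ψ (b ⊗ e)) = homTrace e (b' ⊗ e')
      ((𝟙 b' ⊗≫ η_ b' b ▷ b' ⊗≫ b' ◁ h ▷ b' ⊗≫ b' ◁ A ◁ ε_ b' b ⊗≫ 𝟙 (b' ⊗ A)) ▷ e' ≫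
        (α_ b' A e').hom ≫ b' ◁ ψ e') := by
  set s : b' ⟶ b' ⊗ A :=
    𝟙 b' ⊗≫ η_ b' b ▷ b' ⊗≫ b' ◁ h ▷ b' ⊗≫ b' ◁ A ◁ ε_ b' b ⊗≫ 𝟙 (b' ⊗ A) with hs
  have hz : η_ b' b ≫ s ▷ b = η_ b' b ≫ b' ◁ h ≫ (α_ b' A b).inv := by
    calc _ = 𝟙 _ ⊗≫ (𝟙_ C ◁ η_ b' b ≫ η_ b' b ▷ (b' ⊗ b)) ⊗≫ b' ◁ h ▷ b' ▷ b ⊗≫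
          b' ◁ A ◁ ε_ b' b ▷ b ⊗≫ 𝟙 ((b' ⊗ A) ⊗ b) := by
          rw [hs]; monoidal
      _ = 𝟙 _ ⊗≫ η_ b' b ⊗≫ b' ◁ (b ◁ η_ b' b ≫ h ▷ (b' ⊗ b)) ⊗≫
          b' ◁ A ◁ ε_ b' b ▷ b ⊗≫ 𝟙 ((b' ⊗ A) ⊗ b) := by
          rw [whisker_exchange]; monoidal
      _ = 𝟙 _ ⊗≫ η_ b' b ⊗≫ b' ◁ h ⊗≫ b' ◁ A ◁ (b ◁ η_ b' b ⊗≫ ε_ b' b ▷ b) ⊗≫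
          𝟙 ((b' ⊗ A) ⊗ b) := by
          rw [whisker_exchange]; monoidal
      _ = _ := by
          rw [ExactPairing.coevaluation_evaluation'']; monoidal
  rw [homTrace'_apply, homTrace_apply,
    ← LinearMap.trace_conj' _ (tensorLeftHomLinearEquiv e b' b e')]
  congr 1
  ext u
  obtain ⟨w, rfl⟩ := (tensorLeftHomLinearEquiv e b' b e').surjective u
  rw [LinearEquiv.conj_apply_apply, LinearEquiv.symm_apply_apply]
  change (λ_ _).inv ≫ η_ b' b ▷ e ≫ (α_ _ _ _).hom ≫
      b' ◁ ((h ▷ e ≫ (α_ A b e).hom ≫ ψ (b ⊗ e)) ≫ w) =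
    ((λ_ _).inv ≫ η_ b' b ▷ e ≫ (α_ _ _ _).hom ≫ b' ◁ w) ≫
      s ▷ e' ≫ (α_ b' A e').hom ≫ b' ◁ ψ e'
  calc _ = 𝟙 _ ⊗≫ (η_ b' b ≫ b' ◁ h ≫ (α_ b' A b).inv) ▷ e ⊗≫ b' ◁ A ◁ w ⊗≫ b' ◁ ψ e' := by
        rw [Category.assoc, Category.assoc, ← hψ]; monoidal
    _ = 𝟙 _ ⊗≫ η_ b' b ▷ e ⊗≫ (s ▷ (b ⊗ e) ≫ (b' ⊗ A) ◁ w) ⊗≫ b' ◁ ψ e' := by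
        rw [← hz]; monoidal
    _ = _ := by
        rw [← whisker_exchange]; monoidal

/-- Handle slide: a loop summed over all `e` with weight `d_e` absorbs the strand `b`. Expanding the
traces over simples `e'`, rotating `b`, and exchanging `e` with `e'` leaves an expression in which
`ψ` enters only through its partial traces over simples. -/
theorem sum_dim_mul_qtr_eq {A b b' : C} [ExactPairing b' b] (ψ φ : ∀ V : C, A ⊗ V ⟶ V)
    (hψ : ∀ {V W : C} (f : V ⟶ W), A ◁ f ≫ ψ W = ψ V ≫ f)
    (hφ : ∀ {V W : C} (f : V ⟶ W), A ◁ f ≫ φ W = φ V ≫ f)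
    (hptr : ∀ e : Irr C, ptr (A := A) (B := 𝟙_ C) (e.obj)ᘁ (ψ e.obj ≫ (λ_ e.obj).inv) =
      ptr (A := A) (B := 𝟙_ C) (e.obj)ᘁ (φ e.obj ≫ (λ_ e.obj).inv)) (h : b ⟶ A ⊗ b) :
    ∑ e : Irr C, dim e.obj * qtr (b ⊗ e.obj) (h ▷ e.obj ≫ (α_ A b e.obj).hom ≫ ψ (b ⊗ e.obj)) =
    ∑ e : Irr C, dim e.obj * qtr (b ⊗ e.obj)
      (h ▷ e.obj ≫ (α_ A b e.obj).hom ≫ φ (b ⊗ e.obj)) := by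
  set s : b' ⟶ b' ⊗ A :=
    𝟙 b' ⊗≫ η_ b' b ▷ b' ⊗≫ b' ◁ h ▷ b' ⊗≫ b' ◁ A ◁ ε_ b' b ⊗≫ 𝟙 (b' ⊗ A) with hs
  have key : ∀ ψ : ∀ V : C, A ⊗ V ⟶ V, (∀ {V W : C} (f : V ⟶ W), A ◁ f ≫ ψ W = ψ V ≫ f) →
      ∑ e : Irr C, dim e.obj * qtr (b ⊗ e.obj)
        (h ▷ e.obj ≫ (α_ A b e.obj).hom ≫ ψ (b ⊗ e.obj)) =
      ∑ e : Irr C, dim e.obj * qtr b' (s ≫ b' ◁ ptr (A := A) (B := 𝟙_ C) (e.obj)ᘁ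
        (ψ e.obj ≫ (λ_ e.obj).inv) ≫ (ρ_ b').hom) := by
    intro ψ hψ
    have h1 : ∀ e : Irr C, qtr b' (s ≫ b' ◁ ptr (A := A) (B := 𝟙_ C) (e.obj)ᘁ
        (ψ e.obj ≫ (λ_ e.obj).inv) ≫ (ρ_ b').hom) =
        qtr (b' ⊗ e.obj) (s ▷ e.obj ≫ (α_ b' A e.obj).hom ≫ b' ◁ ψ e.obj) := by
      intro e
      rw [qtr_tensor (e.obj)ᘁ, ← ptr_whiskerLeft, ← ptr_comp]
      congr 2
      simp
    simp only [h1]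
    simp only [qtr_eq_sum_homTrace, homTrace_eq_homTrace' _ (_ ▷ _ ≫ (α_ A b _).hom ≫ _), hs,
      homTrace'_tensor_eq (b' := b') ψ hψ, Finset.mul_sum]
    rw [Finset.sum_comm]
    exact Finset.sum_congr rfl fun _ _ => Finset.sum_congr rfl fun _ _ => by ring
  rw [key ψ hψ, key φ hφ]
  simp only [hptr]

/-- A simple object which is encircled by every strand like the unit is transparent. -/
theorem doubleBraiding_eq_id (X : C) [Simple X] (hX : ∀ e : Irr C, chi X e.obj = dim e.obj)
    (b : C) : doubleBraiding X b = 𝟙 (X ⊗ b) := by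
  obtain ⟨X', ⟨_⟩⟩ : ∃ X' : C, Nonempty (ExactPairing X X') :=
    ⟨HasRightDual.rightDual X, ⟨inferInstance⟩⟩
  -- `ψ` caps off `X' ⊗ X` after linking `X` with `V`, and `φ` caps it off directly. Bending back
  -- shows that `ψ b = φ b` is the claim.
  let ψ : ∀ V : C, (X' ⊗ X) ⊗ V ⟶ V := fun V => (α_ _ _ _).hom ≫ X' ◁ doubleBraiding X V ≫
    (α_ _ _ _).inv ≫ ε_ X X' ▷ V ≫ (λ_ V).hom
  let φ : ∀ V : C, (X' ⊗ X) ⊗ V ⟶ V := fun V => ε_ X X' ▷ V ≫ (λ_ V).hom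
  have hφ : ∀ {V W : C} (f : V ⟶ W), (X' ⊗ X) ◁ f ≫ φ W = φ V ≫ f := by
    intro V W f
    simp only [φ, whisker_exchange_assoc, leftUnitor_naturality, Category.assoc]
  have hψ : ∀ {V W : C} (f : V ⟶ W), (X' ⊗ X) ◁ f ≫ ψ W = ψ V ≫ f := by
    intro V W f
    have h1 : (X' ⊗ X) ◁ f ≫ (α_ _ _ _).hom ≫ X' ◁ doubleBraiding X W ≫ (α_ _ _ _).inv =
        ((α_ _ _ _).hom ≫ X' ◁ doubleBraiding X V ≫ (α_ _ _ _).inv) ≫ (X' ⊗ X) ◁ f := by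
      simp only [tensor_whiskerLeft, Category.assoc, Iso.inv_hom_id_assoc, Iso.cancel_iso_hom_left]
      rw [← whiskerLeft_comp_assoc, doubleBraiding_naturality_right, whiskerLeft_comp_assoc]
    have h2 := hφ f
    simp only [φ, Category.assoc] at h2
    simp only [ψ, Category.assoc, reassoc_of% h1, h2]
  have hXe : ∀ e : Irr C, encircle e.obj X = dim e.obj • 𝟙 X := fun e => by
    rw [encircle_eq_smul, hX]
  have hptrφ : ∀ e : Irr C, ptr (A := X' ⊗ X) (B := 𝟙_ C) (e.obj)ᘁ (φ e.obj ≫ (λ_ e.obj).inv) =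
      dim e.obj • ε_ X X' := by
    intro e
    have h1 : φ e.obj ≫ (λ_ e.obj).inv = 𝟙 _ ≫ ε_ X X' ▷ e.obj := by simp [φ]
    rw [h1, ptr_whiskerRight_comp, ptr_id, Linear.smul_comp, Category.id_comp]
  have hptrψ : ∀ e : Irr C, ptr (A := X' ⊗ X) (B := 𝟙_ C) (e.obj)ᘁ (ψ e.obj ≫ (λ_ e.obj).inv) =
      dim e.obj • ε_ X X' := by
    intro e
    have h1 : ψ e.obj ≫ (λ_ e.obj).inv = ((α_ _ _ _).hom ≫ X' ◁ doubleBraiding X e.obj ≫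
      (α_ _ _ _).inv) ≫ ε_ X X' ▷ e.obj := by simp [ψ]
    rw [h1, ptr_whiskerRight_comp, ptr_whiskerLeft, ← encircle, hXe]
    simp
  have hφb : ∀ e : Irr C, ptr (e.obj)ᘁ ((α_ (X' ⊗ X) b e.obj).hom ≫ φ (b ⊗ e.obj)) =
      dim e.obj • φ b := by
    intro e
    have h1 : (α_ (X' ⊗ X) b e.obj).hom ≫ φ (b ⊗ e.obj) = 𝟙 _ ≫ φ b ▷ e.obj := by simp [φ]
    rw [h1, ptr_whiskerRight_comp, ptr_id, Linear.smul_comp, Category.id_comp]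
  have hψb : ∀ e : Irr C, ptr (e.obj)ᘁ ((α_ (X' ⊗ X) b e.obj).hom ≫ ψ (b ⊗ e.obj)) =
      dim e.obj • ψ b := by
    intro e
    have h1 : (α_ (X' ⊗ X) b e.obj).hom ≫ ψ (b ⊗ e.obj) = (α_ _ _ _).hom ▷ e.obj ≫
        ((α_ _ _ _).hom ≫ X' ◁ ((α_ X b e.obj).hom ≫ doubleBraiding X (b ⊗ e.obj) ≫
        (α_ X b e.obj).inv) ≫ (α_ _ _ _).inv) ≫
        ((α_ _ _ _).inv ≫ ε_ X X' ▷ b ≫ (λ_ b).hom) ▷ e.obj := by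
      simp only [ψ]
      monoidal
    rw [h1, ptr_comp, ptr_whiskerLeft, ptr_doubleBraiding_tensor, hXe]
    simp [ψ, doubleBraiding]
  -- Closing off `e` contributes `d_e` in both cases, so the handle slide yields this equality
  -- multiplied by `D² ≠ 0`.
  have hqtr : ∀ h : b ⟶ (X' ⊗ X) ⊗ b, qtr b (h ≫ ψ b) = qtr b (h ≫ φ b) := by
    intro h
    have h1 := sum_dim_mul_qtr_eq (b' := ᘁb) ψ φ hψ hφ (fun e => (hptrψ e).trans (hptrφ e).symm) h
    have h2 : ∀ e : Irr C, qtr (b ⊗ e.obj)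
        (h ▷ e.obj ≫ (α_ _ b e.obj).hom ≫ ψ (b ⊗ e.obj)) = dim e.obj * qtr b (h ≫ ψ b) := by
      intro e
      rw [qtr_tensor (e.obj)ᘁ, ptr_comp_whiskerRight, hψb, Linear.comp_smul, map_smul, smul_eq_mul]
    have h3 : ∀ e : Irr C, qtr (b ⊗ e.obj)
        (h ▷ e.obj ≫ (α_ _ b e.obj).hom ≫ φ (b ⊗ e.obj)) = dim e.obj * qtr b (h ≫ φ b) := by
      intro e
      rw [qtr_tensor (e.obj)ᘁ, ptr_comp_whiskerRight, hφb, Linear.comp_smul, map_smul, smul_eq_mul]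
    simp only [h2, h3, ← mul_assoc, ← Finset.sum_mul, ← pow_two] at h1
    exact mul_left_cancel₀ globalDim_ne_zero h1
  have hψφ : ψ b = φ b := by
    rw [← sub_eq_zero]
    apply eq_zero_of_qtr_eq_zero
    intro f
    rw [Preadditive.comp_sub, map_sub, hqtr, sub_self]
  apply (tensorLeftHomEquiv (X ⊗ b) X X' b).symm.injective
  change X' ◁ doubleBraiding X b ≫ (α_ _ _ _).inv ≫ ε_ X X' ▷ b ≫ (λ_ b).hom =
    X' ◁ 𝟙 (X ⊗ b) ≫ (α_ _ _ _).inv ≫ ε_ X X' ▷ b ≫ (λ_ b).hom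
  rw [← cancel_epi (α_ X' X b).hom]
  simpa [ψ, φ] using hψφ

end Transparent

/-! ### Traces of idempotents and involutions. -/

section LinearMap

variable {V : Type*} [AddCommGroup V] [Module ℂ V] [FiniteDimensional ℂ V]

theorem exists_nat_trace_of_isIdempotentElem {f : V →ₗ[ℂ] V} (hf : IsIdempotentElem f) :
    ∃ n : ℕ, LinearMap.trace ℂ V f = n :=
  ⟨_, (LinearMap.IsIdempotentElem.isProj_range f hf).trace⟩

/-- The projection `(1 + f) / 2` has natural trace. -/
theorem exists_int_trace_of_mul_self_eq_one {f : V →ₗ[ℂ] V} (hf : f * f = 1) :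
    ∃ n : ℤ, LinearMap.trace ℂ V f = n := by
  have h : IsIdempotentElem ((1 / 2 : ℂ) • (1 + f)) := by
    rw [IsIdempotentElem, smul_mul_smul_comm, mul_add, add_mul, add_mul, hf, one_mul, one_mul,
      mul_one, ← smul_smul]
    congr 1
    rw [add_comm f 1, ← two_smul ℂ (1 + f), smul_smul]
    norm_num
  obtain ⟨n, hn⟩ := exists_nat_trace_of_isIdempotentElem h
  refine ⟨2 * n - Module.finrank ℂ V, ?_⟩
  rw [map_smul, map_add, LinearMap.trace_one, smul_eq_mul] at hn
  push_cast
  rw [← hn]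
  ring

end LinearMap

/-! ### The recursion for antisymmetrizers, in an abstract algebra. -/

section Antisymmetrizer

variable {A : Type*} [Ring A] [Algebra ℂ A]

/-- Here `E` and `E'` play the antisymmetrizers on `k` and `k - 1` strands, and `s`, `s'` the last
two transpositions. Expanding the second `E` in `E s E` gives terms in `E s` and `E s s' E'`; right
multiplication by `s` sends the first to `E` and, by the braid relation, negates the second. -/
theorem antisymmetrizer_step_mul {k : ℂ} (hk : k ≠ 0) {E E' s s' : A}
    (hEE' : E * E' = E) (hE : E = k⁻¹ • (E' - (k - 1) • (E' * s' * E')))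
    (hEs' : E * s' = -E) (hcomm : E' * s = s * E') (hs : s * s = 1)
    (hbraid : s * s' * s = s' * s * s') :
    ((k + 1)⁻¹ • (E - k • (E * s * E))) * s = -((k + 1)⁻¹ • (E - k • (E * s * E))) := by
  have h1 : E * s * E' = E * s := by rw [mul_assoc, ← hcomm, ← mul_assoc, hEE']
  have h3 : E * s * E = k⁻¹ • (E * s - (k - 1) • (E * s * s' * E')) := by
    calc E * s * E = E * s * (k⁻¹ • (E' - (k - 1) • (E' * s' * E'))) := by rw [← hE]
      _ = _ := by
        rw [mul_smul_comm, mul_sub, mul_smul_comm, ← mul_assoc, ← mul_assoc, h1]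
  have h4 : E * s * s' * E' * s = -(E * s * s' * E') := by
    rw [mul_assoc, hcomm, ← mul_assoc, mul_assoc E s s', mul_assoc E (s * s') s, hbraid,
      ← mul_assoc, ← mul_assoc, hEs', neg_mul, neg_mul, neg_mul, mul_assoc E s s']
  have h2 : E * s * E * s = k⁻¹ • (E + (k - 1) • (E * s * s' * E')) := by
    rw [h3, smul_mul_assoc, sub_mul, smul_mul_assoc, h4, mul_assoc E s s, hs, mul_one, smul_neg,
      sub_neg_eq_add]
  rw [smul_mul_assoc, sub_mul, smul_mul_assoc, h2, smul_smul, mul_inv_cancel₀ hk, one_smul,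
    ← smul_neg, neg_sub, h3, smul_smul, mul_inv_cancel₀ hk, one_smul]
  congr 1
  abel

theorem antisymmetrizer_step_idem {k : ℂ} (hk : k ≠ 0) (hk1 : k + 1 ≠ 0) {E E' s s' : A}
    (hEE : E * E = E)
    (hEE' : E * E' = E) (hE : E = k⁻¹ • (E' - (k - 1) • (E' * s' * E')))
    (hEs' : E * s' = -E) (hcomm : E' * s = s * E') (hs : s * s = 1)
    (hbraid : s * s' * s = s' * s * s') :
    IsIdempotentElem ((k + 1)⁻¹ • (E - k • (E * s * E))) := by
  set e := (k + 1)⁻¹ • (E - k • (E * s * E)) with he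
  have h1 : e * s = -e := antisymmetrizer_step_mul hk hEE' hE hEs' hcomm hs hbraid
  have h2 : e * E = e := by
    rw [he, smul_mul_assoc, sub_mul, smul_mul_assoc, mul_assoc _ E E, hEE]
  rw [IsIdempotentElem]
  conv_lhs => rw [he]
  rw [← he, mul_smul_comm, mul_sub, mul_smul_comm, ← mul_assoc, ← mul_assoc, h2, h1, neg_mul, h2,
    smul_neg, sub_neg_eq_add, show e + k • e = (k + 1) • e by rw [add_smul, one_smul, add_comm],
    smul_smul, inv_mul_cancel₀ hk1, one_smul]

end Antisymmetrizer

/-! ### Antisymmetrizers on tensor powers and integral dimensions. -/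

section TensorPower

variable {C : Type u} [Category.{v} C] [Abelian C] [Linear ℂ C] [MonoidalCategory C]
  [MonoidalPreadditive C] [MonoidalLinear ℂ C]

/-- Tensoring with `X` on the right as a homomorphism of endomorphism algebras. -/
def whiskerRightHom (T X : C) : End T →ₐ[ℂ] End (T ⊗ X) where
  toFun f := f ▷ X
  map_one' := id_whiskerRight T X
  map_mul' f g := comp_whiskerRight g f X
  map_zero' := MonoidalPreadditive.zero_whiskerRight
  map_add' f g := MonoidalPreadditive.add_whiskerRight f g
  commutes' z := by
    simp only [Algebra.algebraMap_eq_smul_one]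
    exact (MonoidalLinear.smul_whiskerRight z (𝟙 T) X).trans
      (congrArg (z • ·) (id_whiskerRight T X))

theorem whiskerRightHom_apply (T X : C) (f : End T) : whiskerRightHom T X f = f ▷ X := rfl

variable [BraidedCategory C]

/-- The braiding of the last two factors. -/
def lastBraiding (T X : C) : End ((T ⊗ X) ⊗ X) :=
  (α_ T X X).hom ≫ T ◁ (β_ X X).hom ≫ (α_ T X X).inv

omit [Abelian C] [Linear ℂ C] [MonoidalPreadditive C] [MonoidalLinear ℂ C] in
theorem lastBraiding_mul_self {X : C} (hX : doubleBraiding X X = 𝟙 (X ⊗ X)) (T : C) :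
    lastBraiding T X * lastBraiding T X = 1 := by
  rw [doubleBraiding] at hX
  change ((α_ T X X).hom ≫ T ◁ (β_ X X).hom ≫ (α_ T X X).inv) ≫
    ((α_ T X X).hom ≫ T ◁ (β_ X X).hom ≫ (α_ T X X).inv) = 𝟙 _
  simp only [Category.assoc, Iso.inv_hom_id_assoc]
  rw [← whiskerLeft_comp_assoc, hX]
  simp

theorem lastBraiding_braid (T X : C) :
    lastBraiding (T ⊗ X) X * whiskerRightHom ((T ⊗ X) ⊗ X) X (lastBraiding T X) *
      lastBraiding (T ⊗ X) X =
    whiskerRightHom ((T ⊗ X) ⊗ X) X (lastBraiding T X) * lastBraiding (T ⊗ X) X *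
      whiskerRightHom ((T ⊗ X) ⊗ X) X (lastBraiding T X) := by
  have y := BraidedCategory.yang_baxter' X X X
  simp only [End.mul_def, whiskerRightHom_apply, lastBraiding]
  calc _ = 𝟙 (((T ⊗ X) ⊗ X) ⊗ X) ⊗≫ T ◁ (𝟙 ((X ⊗ X) ⊗ X) ⊗≫ (X ◁ (β_ X X).hom ⊗≫
        (β_ X X).hom ▷ X ⊗≫ X ◁ (β_ X X).hom) ⊗≫ 𝟙 ((X ⊗ X) ⊗ X)) ⊗≫
        𝟙 (((T ⊗ X) ⊗ X) ⊗ X) := by monoidal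
    _ = 𝟙 (((T ⊗ X) ⊗ X) ⊗ X) ⊗≫ T ◁ ((β_ X X).hom ▷ X ⊗≫ X ◁ (β_ X X).hom ⊗≫
        (β_ X X).hom ▷ X) ⊗≫ 𝟙 (((T ⊗ X) ⊗ X) ⊗ X) := by rw [← y]
    _ = _ := by monoidal

theorem whiskerRightHom_mul_lastBraiding {T : C} (X : C) (f : End T) :
    whiskerRightHom (T ⊗ X) X (whiskerRightHom T X f) * lastBraiding T X =
      lastBraiding T X * whiskerRightHom (T ⊗ X) X (whiskerRightHom T X f) := by
  have h : ((α_ T X X).hom ≫ T ◁ (β_ X X).hom ≫ (α_ T X X).inv) ≫ (f : T ⟶ T) ▷ X ▷ X =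
      (f : T ⟶ T) ▷ X ▷ X ≫ (α_ T X X).hom ≫ T ◁ (β_ X X).hom ≫ (α_ T X X).inv := by
    simp only [Category.assoc]
    rw [← MonoidalCategory.associator_inv_naturality_left, whisker_exchange_assoc]
    simp
  exact h

variable [RigidCategory C] [FusionCategory C] [RibbonCategory C]

/-- Close the last strand: a free strand gives `dim X`, and a crossing gives the trivial twist. -/
theorem qtr_antisymmetrizer_step {T X : C} (hθ : twist X = 𝟙 X) {e : End (T ⊗ X)}
    (he : IsIdempotentElem e) (k : ℂ) :
    qtr ((T ⊗ X) ⊗ X) ((k + 1)⁻¹ • (whiskerRightHom _ X e -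
      k • (whiskerRightHom _ X e * lastBraiding T X * whiskerRightHom _ X e)) :
      End ((T ⊗ X) ⊗ X)) = qtr (T ⊗ X) e * ((dim X - k) / (k + 1)) := by
  rw [qtr_tensor Xᘁ]
  have h : ptr Xᘁ ((k + 1)⁻¹ • ((e : T ⊗ X ⟶ T ⊗ X) ▷ X ≫ 𝟙 _ + (-k) •
      ((e : T ⊗ X ⟶ T ⊗ X) ▷ X ≫ ((α_ T X X).hom ≫ T ◁ (β_ X X).hom ≫ (α_ T X X).inv) ≫
      (e : T ⊗ X ⟶ T ⊗ X) ▷ X))) = ((k + 1)⁻¹ * (dim X - k)) • (e : T ⊗ X ⟶ T ⊗ X) := by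
    have hee : (e : T ⊗ X ⟶ T ⊗ X) ≫ e = e := he
    rw [ptr_smul, ptr_add, ptr_smul, ptr_comp_whiskerRight, ptr_comp, ptr_whiskerLeft,
      ptr_braiding, ptr_id, hθ, whiskerLeft_id, Category.id_comp, hee, Linear.comp_smul,
      Category.comp_id, ← add_smul, smul_smul, sub_eq_add_neg]
  have h' := congrArg (qtr (T ⊗ X)) h
  rw [map_smul, smul_eq_mul, Category.comp_id, neg_smul, ← sub_eq_add_neg] at h'
  refine Eq.trans ?_ (h'.trans (by ring))
  rfl

/-- `T` is the `n`-fold power of `X`. Two consecutive antisymmetrizers, on `n + 1` and `n + 2`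
strands, are carried because the inductive step uses both. -/
theorem exists_antisymmetrizer {X : C} (hX : doubleBraiding X X = 𝟙 (X ⊗ X))
    (hθ : twist X = 𝟙 X) (n : ℕ) :
    ∃ (T : C) (e' : End (T ⊗ X)) (e : End ((T ⊗ X) ⊗ X)),
      IsIdempotentElem e' ∧ qtr (T ⊗ X) e' = cchoose (dim X) (n + 1) ∧
      IsIdempotentElem e ∧ e * whiskerRightHom _ X e' = e ∧ e * lastBraiding T X = -e ∧
      e = ((n + 1 : ℂ) + 1)⁻¹ • (whiskerRightHom _ X e' - (n + 1 : ℂ) •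
        (whiskerRightHom _ X e' * lastBraiding T X * whiskerRightHom _ X e')) := by
  induction n with
  | zero =>
    have hs := lastBraiding_mul_self hX (𝟙_ C)
    refine ⟨𝟙_ C, 1, (2 : ℂ)⁻¹ • (1 - lastBraiding (𝟙_ C) X), IsIdempotentElem.one, ?_, ?_, ?_, ?_,
      ?_⟩
    · change qtr (𝟙_ C ⊗ X) (𝟙 _) = _
      rw [← dim_eq, dim_eq_of_iso (λ_ X)]
      simp [cchoose]
    · rw [IsIdempotentElem, smul_mul_smul_comm, mul_sub, sub_mul, sub_mul, hs, one_mul, one_mul,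
        mul_one, ← smul_smul]
      congr 1
      rw [← neg_sub 1 (lastBraiding (𝟙_ C) X), sub_neg_eq_add, ← two_smul ℂ, smul_smul]
      norm_num
    · rw [map_one, mul_one]
    · rw [smul_mul_assoc, sub_mul, hs, one_mul, ← smul_neg, neg_sub]
    · rw [map_one, one_mul, mul_one]
      norm_num
  | succ n ih =>
    obtain ⟨T, e', e, hi, hq, hei, hee', hes, he⟩ := ih
    have hk : (n + 1 : ℂ) + 1 ≠ 0 := by exact_mod_cast Nat.succ_ne_zero (n + 1)
    have hk1 : (n + 1 : ℂ) + 1 + 1 ≠ 0 := by exact_mod_cast Nat.succ_ne_zero (n + 2)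
    have hei' : whiskerRightHom _ X e * whiskerRightHom _ X e = whiskerRightHom _ X e := by
      rw [← map_mul, hei]
    have h1 : whiskerRightHom _ X e * whiskerRightHom _ X (whiskerRightHom _ X e') =
        whiskerRightHom _ X e := by rw [← map_mul, hee']
    have h2 : whiskerRightHom _ X e = ((n + 1 : ℂ) + 1)⁻¹ •
        (whiskerRightHom _ X (whiskerRightHom _ X e') - ((n + 1 : ℂ) + 1 - 1) •
        (whiskerRightHom _ X (whiskerRightHom _ X e') *
        whiskerRightHom ((T ⊗ X) ⊗ X) X (lastBraiding T X) *
        whiskerRightHom _ X (whiskerRightHom _ X e'))) := by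
      conv_lhs => rw [he]
      rw [map_smul, map_sub, map_smul, map_mul, map_mul, add_sub_cancel_right]
    have h3 : whiskerRightHom _ X e * whiskerRightHom ((T ⊗ X) ⊗ X) X (lastBraiding T X) =
        -whiskerRightHom _ X e := by rw [← map_mul, hes, map_neg]
    have h4 := whiskerRightHom_mul_lastBraiding X e'
    have h5 := lastBraiding_mul_self hX (T ⊗ X)
    have h6 := lastBraiding_braid T X
    refine ⟨T ⊗ X, e, _, hei, ?_, antisymmetrizer_step_idem hk hk1 hei' h1 h2 h3 h4 h5 h6, ?_,
      antisymmetrizer_step_mul hk h1 h2 h3 h4 h5 h6, ?_⟩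
    · have h7 := qtr_antisymmetrizer_step hθ hi (n + 1 : ℂ)
      rw [← he, hq] at h7
      rw [cchoose_succ]
      push_cast
      exact h7
    · rw [smul_mul_assoc, sub_mul, smul_mul_assoc, mul_assoc _ (whiskerRightHom _ X e), hei']
    · push_cast
      rfl

theorem isIntegral_qtr_of_isIdempotentElem {X : C} {e : End X} (he : IsIdempotentElem e) :
    IsIntegral ℤ (qtr X e) := by
  rw [qtr_eq_sum_homTrace]
  refine IsIntegral.sum _ fun b _ => (isIntegral_dim b.obj).mul ?_
  have he' : (e : X ⟶ X) ≫ e = e := he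
  have h : IsIdempotentElem (Linear.rightComp ℂ b.obj (e : X ⟶ X)) := by
    ext u
    simp [he']
  obtain ⟨n, hn⟩ := exists_nat_trace_of_isIdempotentElem h
  rw [homTrace_apply, hn]
  exact isIntegral_algebraMap (x := (n : ℤ))

theorem exists_int_dim {X : C} (hX : doubleBraiding X X = 𝟙 (X ⊗ X)) (hθ : twist X = 𝟙 X) :
    ∃ m : ℤ, dim X = m := by
  refine exists_int_of_isIntegral_cchoose fun n => ?_
  cases n with
  | zero => simpa [cchoose] using isIntegral_one
  | succ n =>
    obtain ⟨T, e', -, he', hq, -⟩ := exists_antisymmetrizer hX hθ n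
    rw [← hq]
    exact isIntegral_qtr_of_isIdempotentElem he'

end TensorPower

/-! ### Evaluation of the sum. -/

section Bantay

variable {C : Type u} [Category.{v} C] [Abelian C] [Linear ℂ C] [MonoidalCategory C]
  [MonoidalPreadditive C] [MonoidalLinear ℂ C] [RigidCategory C] [FusionCategory C]
  [BraidedCategory C] [RibbonCategory C]

theorem twist_eq_smul (X : C) [Simple X] : twist X = twistScalar X • 𝟙 X :=
  (scalar_smul_id _).symm

theorem twistScalar_ne_zero (X : C) [Simple X] : twistScalar X ≠ 0 := by
  intro h
  have h1 : twist X ≫ (RibbonCategory.twist (C := C)).inv.app X = 𝟙 X :=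
    (RibbonCategory.twist (C := C)).hom_inv_id_app X
  rw [twist_eq_smul, h, zero_smul, zero_comp] at h1
  exact id_nonzero X h1.symm

theorem twist_rightDual (X : C) [Simple X] : twist Xᘁ = twistScalar X • 𝟙 Xᘁ := by
  have h : twist Xᘁ = (twist X)ᘁ := RibbonCategory.twist_dual X
  have h1 : (twistScalar X • 𝟙 X)ᘁ = twistScalar X • (𝟙 X)ᘁ := by
    simp [rightAdjointMate]
  rw [h, twist_eq_smul, h1, rightAdjointMate_id]

omit [FusionCategory C] in
theorem twist_tensor_of_eq_smul {X Y : C} {x y : ℂ} (hX : twist X = x • 𝟙 X)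
    (hY : twist Y = y • 𝟙 Y) : twist (X ⊗ Y) = (x * y) • doubleBraiding X Y := by
  rw [twist_tensor, hX, hY, MonoidalCategory.tensorHom_def]
  simp [smul_smul, mul_comm]

theorem homTrace_twist_sq (Y : C) [Simple Y] (X : C) :
    homTrace Y X (twist X ≫ twist X) = twistScalar Y ^ 2 * Module.finrank ℂ (Y ⟶ X) := by
  have h : Linear.rightComp ℂ Y (twist X ≫ twist X) =
      twistScalar Y ^ 2 • (1 : (Y ⟶ X) →ₗ[ℂ] (Y ⟶ X)) := by
    ext u
    simp only [Linear.rightComp_apply, LinearMap.smul_apply, Module.End.one_apply]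
    rw [← Category.assoc, twist_naturality, twist_naturality, twist_eq_smul Y]
    simp [smul_smul, pow_two]
  rw [homTrace_apply, h, map_smul, LinearMap.trace_one, smul_eq_mul]

theorem sum_dim_twist_sq_mul_fusionCoeff (c X : C) :
    ∑ b : Irr C, dim b.obj * (twistScalar b.obj ^ 2 * (fusionCoeff b.obj c X : ℂ)) =
      qtr (X ⊗ cᘁ) (twist (X ⊗ cᘁ) ≫ twist (X ⊗ cᘁ)) := by
  rw [qtr_eq_sum_homTrace]
  refine Finset.sum_congr rfl fun b _ => ?_
  rw [homTrace_twist_sq, fusionCoeff, (tensorRightHomLinearEquiv b.obj c cᘁ X).finrank_eq]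

/-- Both sides evaluate one link, `Y` around two self-braided strands of `X`: closing an `X` strand
first gives the left side, closing `Y` first the right. -/
theorem twistScalar_mul_qtr_doubleBraiding_sq (X : C) [Simple X] (Y : C) :
    twistScalar X * qtr (X ⊗ Y) (doubleBraiding X Y ≫ doubleBraiding X Y) =
      qtr (X ⊗ X) (encircle Y (X ⊗ X) ≫ (β_ X X).hom) := by
  have h1 : qtr (X ⊗ Y) (doubleBraiding X Y ≫ doubleBraiding X Y) =
      qtr (Y ⊗ X) (doubleBraiding Y X ≫ doubleBraiding Y X) := by
    have := qtr_comm (β_ X Y).hom (doubleBraiding Y X ≫ (β_ Y X).hom)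
    simpa [doubleBraiding] using this
  have h2 : qtr (Y ⊗ (X ⊗ X)) (doubleBraiding Y (X ⊗ X) ≫ Y ◁ (β_ X X).hom) =
      twistScalar X * qtr (Y ⊗ X) (doubleBraiding Y X ≫ doubleBraiding Y X) := by
    rw [qtr_apply, traceHom_doubleBraiding_braiding, ← qtr_apply, twist_eq_smul]
    simp
  have h3 : qtr (Y ⊗ (X ⊗ X)) (doubleBraiding Y (X ⊗ X) ≫ Y ◁ (β_ X X).hom) =
      qtr ((X ⊗ X) ⊗ Y) (doubleBraiding (X ⊗ X) Y ≫ (β_ X X).hom ▷ Y) := by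
    have := qtr_comm (β_ Y (X ⊗ X)).hom ((β_ (X ⊗ X) Y).hom ≫ Y ◁ (β_ X X).hom)
    rw [doubleBraiding, Category.assoc, this, Category.assoc,
      BraidedCategory.braiding_naturality_right, doubleBraiding, Category.assoc]
  rw [h1, ← h2, h3, qtr_tensor Yᘁ, ptr_whiskerRight_comp, encircle]

theorem homTrace_encircle_comp (e : C) [Simple e] (Y : C) {X : C} (f : X ⟶ X) :
    homTrace e X (encircle Y X ≫ f) = chi e Y * homTrace e X f := by
  have h : Linear.rightComp ℂ e (encircle Y X ≫ f) = chi e Y • Linear.rightComp ℂ e f := by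
    ext u
    simp only [Linear.rightComp_apply, LinearMap.smul_apply]
    rw [← Category.assoc, encircle_naturality, encircle_eq_smul e]
    simp
  rw [homTrace_apply, h, map_smul, smul_eq_mul, homTrace_apply]

theorem sum_fusionCoeff_eq (X : C) [Simple X] :
    ∑ b : Irr C, ∑ c : Irr C, (fusionCoeff b.obj c.obj X : ℂ) * dim b.obj * dim c.obj *
      (twistScalar b.obj / twistScalar c.obj) ^ 2 =
    ∑ e : Irr C, dim e.obj * (twistScalar X * homTrace e.obj (X ⊗ X) (β_ X X).hom) *
      ∑ c : Irr C, dim c.obj * chi e.obj c.obj := by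
  have h1 : ∀ c : Irr C, ∑ b : Irr C, (fusionCoeff b.obj c.obj X : ℂ) * dim b.obj * dim c.obj *
      (twistScalar b.obj / twistScalar c.obj) ^ 2 = dim c.obj * (twistScalar X *
      ∑ e : Irr C, dim e.obj * (chi e.obj (c.obj)ᘁ *
        homTrace e.obj (X ⊗ X) (β_ X X).hom)) := by
    intro c
    have hc := twistScalar_ne_zero c.obj
    calc _ = dim c.obj / twistScalar c.obj ^ 2 * ∑ b : Irr C,
          dim b.obj * (twistScalar b.obj ^ 2 * (fusionCoeff b.obj c.obj X : ℂ)) := by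
          rw [Finset.mul_sum]
          refine Finset.sum_congr rfl fun b _ => ?_
          rw [div_pow]
          ring
      _ = dim c.obj * (twistScalar X * (twistScalar X * qtr (X ⊗ (c.obj)ᘁ)
          (doubleBraiding X (c.obj)ᘁ ≫ doubleBraiding X (c.obj)ᘁ))) := by
          rw [sum_dim_twist_sq_mul_fusionCoeff,
            twist_tensor_of_eq_smul (twist_eq_smul X) (twist_rightDual c.obj)]
          simp only [Linear.smul_comp, Linear.comp_smul, map_smul, smul_eq_mul]
          field_simp
      _ = _ := by
          rw [twistScalar_mul_qtr_doubleBraiding_sq, qtr_eq_sum_homTrace]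
          simp only [homTrace_encircle_comp]
  rw [Finset.sum_comm]
  simp only [h1]
  -- Duality permutes the simples and preserves dimensions, so `c*` may be replaced by `c`.
  have h2 : ∀ e : Irr C, ∑ c : Irr C, dim c.obj * chi e.obj c.obj =
      ∑ c : Irr C, dim c.obj * chi e.obj (c.obj)ᘁ := by
    intro e
    rw [← sum_rightDual (fun Y : C => dim Y * chi e.obj Y)
      fun i => by rw [dim_eq_of_iso i, chi_congr _ i]]
    simp only [dim_rightDual]
  simp only [h2, Finset.mul_sum]
  rw [Finset.sum_comm]
  exact Finset.sum_congr rfl fun _ _ => Finset.sum_congr rfl fun _ _ => by ring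

/-- A transparent simple subobject of `X ⊗ X` has trivial twist. -/
theorem twistScalar_eq_one {e X : C} [Simple e] [Simple X]
    (he : ∀ Y : C, doubleBraiding e Y = 𝟙 (e ⊗ Y)) {u : e ⟶ X ⊗ X} (hu : u ≠ 0) :
    twistScalar e = 1 := by
  let _ : ExactPairing Xᘁ X := BraidedCategory.exactPairing_swap X Xᘁ
  -- The twist acts by `θ_e θ_X` on the source of `w`, since `e` is transparent, and by `θ_X` on the
  -- target.
  set w : e ⊗ Xᘁ ⟶ X := (tensorRightHomLinearEquiv e Xᘁ X X).symm u with hw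
  have hw0 : w ≠ 0 := by
    rw [hw, Ne, LinearEquiv.map_eq_zero_iff]
    exact hu
  have h1 := twist_naturality w
  rw [twist_tensor_of_eq_smul (twist_eq_smul e) (twist_rightDual X), he, twist_eq_smul X,
    Linear.smul_comp, Linear.comp_smul, Category.id_comp, Category.comp_id, ← sub_eq_zero,
    ← sub_smul, smul_eq_zero, or_iff_left hw0, sub_eq_zero] at h1
  exact (mul_right_cancel₀ (twistScalar_ne_zero X) ((one_mul _).trans h1)).symm

theorem exists_int_homTrace_braiding {e X : C} [Simple e] [Simple X] (he : twistScalar e = 1) :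
    ∃ m : ℤ, twistScalar X * homTrace e (X ⊗ X) (β_ X X).hom = m := by
  -- The square is composition with `θ_{X ⊗ X}`, which on `Hom(e, X ⊗ X)` is `θ_e = 1`.
  have h : (twistScalar X • Linear.rightComp ℂ e (β_ X X).hom) *
      (twistScalar X • Linear.rightComp ℂ e (β_ X X).hom) = 1 := by
    ext u
    have h1 := twist_naturality u
    rw [twist_tensor_of_eq_smul (twist_eq_smul X) (twist_eq_smul X), twist_eq_smul e, he, one_smul,
      Category.id_comp] at h1
    simpa [smul_smul, doubleBraiding] using h1
  obtain ⟨m, hm⟩ := exists_int_trace_of_mul_self_eq_one h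
  exact ⟨m, by rw [← hm, map_smul, smul_eq_mul, homTrace_apply]⟩

theorem exists_int_mul_globalDim (e X : C) [Simple e] [Simple X] :
    ∃ m : ℤ, dim e * (twistScalar X * homTrace e (X ⊗ X) (β_ X X).hom) *
      ∑ c : Irr C, dim c.obj * chi e c.obj = m * globalDim C := by
  by_cases hchi : ∀ c : Irr C, chi e c.obj = dim c.obj
  · by_cases hu : ∀ u : e ⟶ X ⊗ X, u = 0
    · refine ⟨0, ?_⟩
      have h0 : Linear.rightComp ℂ e (β_ X X).hom = 0 := by
        ext u
        rw [hu u, map_zero, map_zero]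
      rw [homTrace_apply, h0]
      simp
    · push Not at hu
      obtain ⟨u, hu⟩ := hu
      have htr := doubleBraiding_eq_id e hchi
      have hθ := twistScalar_eq_one htr hu
      obtain ⟨m, hm⟩ := exists_int_homTrace_braiding (X := X) hθ
      obtain ⟨d, hd⟩ := exists_int_dim (htr e) (by rw [twist_eq_smul, hθ, one_smul])
      refine ⟨d * m, ?_⟩
      rw [hm, hd]
      simp only [hchi, ← pow_two, globalDim]
      push_cast
      rfl
  · push Not at hchi
    obtain ⟨c, hc⟩ := hchi
    exact ⟨0, by rw [sum_dim_mul_chi_eq_zero e hc]; simp⟩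

theorem exists_int_bantaySum (X : C) [Simple X] : ∃ m : ℤ, bantaySum X = m := by
  choose m hm using fun e : Irr C => exists_int_mul_globalDim e.obj X
  refine ⟨∑ e, m e, ?_⟩
  rw [bantaySum, sum_fusionCoeff_eq]
  simp only [hm]
  rw [← Finset.sum_mul, mul_comm, mul_one_div, mul_div_cancel_right₀ _ globalDim_ne_zero]
  push_cast
  rfl

end Bantay

end

end Premodular

theorem mainTheorem3 {C : Type u} [Category.{v} C] [Abelian C] [Linear ℂ C]
    [MonoidalCategory C] [MonoidalPreadditive C] [MonoidalLinear ℂ C] [RigidCategory C]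
    [Premodular.FusionCategory C] [BraidedCategory C] [Premodular.RibbonCategory C] :
    Premodular.globalDim C ≠ 0 ∧
    ∀ (X : C) [Simple X],
      (∃ r : ℝ, Premodular.bantaySum X = (r : ℂ)) ∧
      (Nonempty (X ≅ Xᘁ) → ∃ m : ℤ, Premodular.bantaySum X = (m : ℂ)) := by
  refine ⟨Premodular.globalDim_ne_zero, fun X _ => ?_⟩
  obtain ⟨m, hm⟩ := Premodular.exists_int_bantaySum X
  exact ⟨⟨m, by rw [hm]; simp⟩, fun _ => ⟨m, hm⟩⟩
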